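/- **Noninterference.** A *machine* consists of states $S$, events $E$, input data $I$, a step relation $s\xrightarrow{\alpha}s'$ with actions $\alpha\in E\cup\{\tau\}$, and a map $\mathrm{init}:I\to S$. Write $s\xrightarrow{t}{}^{*}$ if some finite sequence of steps from $s$ produces the list $t$ of events (silent actions $\tau$ omitted). A *notion of observation* consists of a set $\Omega$ of observers and, for each $o\in\Omega$, a predicate "observable by $o$" on $E$ and a relation $\approx_o$ on $I$. The machine satisfies *termination-insensitive noninterference (TINI)* if for all $o\in\Omega$, all $i_1\approx_o i_2$ and all $t_1,t_2$ with $\mathrm{init}(i_1)\xrightarrow{t_1}{}^{*}$ and $\mathrm{init}(i_2)\xrightarrow{t_2}{}^{*}$, the sublists of the events of $t_1$ and of $t_2$ observable by $o$ are equal after truncating the longer one to the length of the shorter one. **Concrete machine.** Fix a default tag $T_D\in\mathbb Z$. Atoms $n@T$ are pairs of integers (payload, tag). A state $\langle\pi\ \kappa\ \mu\ [\sigma]\ pc\rangle$ consists of a privilege bit $\pi\in\{u,k\}$, kernel and user data memories $\kappa,\mu$ (partial functions from $\mathbb Z$ to atoms), a stack $\sigma$ of atoms and return frames $(pc',\pi')$,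 and an atom $pc$; there are a fixed user program $\iota$ and fixed kernel code $\phi$ (partial functions from $\mathbb N$ to instructions). The instructions are $\mathsf{Add},\mathsf{Sub},\mathsf{Output},\mathsf{Push}\,m,\mathsf{Load},\mathsf{Store},\mathsf{Jump},\mathsf{Bnz}\,k,\mathsf{Call},\mathsf{Ret}$, each with an integer opcode. Kernel cells $0,\dots,6$ are the rule cache, with payloads $(op,T_{pc},T_1,T_2,T_3\,\|\,T_{rpc},T_r)$; the first five are its input part. *User mode.* At $pc=n@T_{pc}$ the instruction $\iota(n)$ has the following effect (top of stack on the left); the cache input it needs is its opcode, $T_{pc}$ and the tags $T_1,T_2,T_3$ shown, with $T_D$ for those not shown. Unless stated otherwise the new $pc$ is $(n+1)@T_{rpc}$. $\mathsf{Add}$: $[n_1@T_1,n_2@T_2,\sigma]\to[(n_1+n_2)@T_r,\sigma]$; $\mathsf{Sub}$: the same with $n_1-n_2$; $\mathsf{Output}$: $[m@T_1,\sigma]\to[\sigma]$, emitting the event $m@T_r$; $\mathsf{Push}\,m$: $[\sigma]\to[m@T_r,\sigma]$; $\mathsf{Load}$, if $\mu(p)=m@T_2$: $[p@T_1,\sigma]\to[m@T_r,\sigma]$;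 $\mathsf{Store}$, if $\mu(p)=k@T_3$: $[p@T_1,m@T_2,\sigma]\to[\sigma]$ and $\mu(p):=m@T_r$; $\mathsf{Jump}$: $[n'@T_1,\sigma]\to[\sigma]$, $pc:=n'@T_{rpc}$; $\mathsf{Bnz}\,k$: $[m@T_1,\sigma]\to[\sigma]$, $pc:=(n+1)@T_{rpc}$ if $m=0$ and $(n+k)@T_{rpc}$ otherwise; $\mathsf{Call}$: $[n'@T_1,a,\sigma]\to[a,((n+1)@T_r,u),\sigma]$, $pc:=n'@T_{rpc}$; $\mathsf{Ret}$: $[(n'@T_1,u),\sigma]\to[\sigma]$, $pc:=n'@T_{rpc}$. If the cache input equals the needed one (hit), this step is made, with $T_{rpc},T_r$ from the cache; otherwise (miss) the needed input is written to the cache, the output part is set to $(T_D,T_D)$ (all written cells tagged $T_D$), the frame $(pc,u)$ is pushed, and the machine goes to kernel mode with $pc=0@T_D$. If the operands needed do not exist, there is no step. *Kernel mode.* Instructions come from $\phi$ and have the same effect on payloads, with $\kappa$ in place of $\mu$ and without using the cache; results and $pc$ get the tag $T_D$, except that $\mathsf{Load}$ and $\mathsf{Store}$ keep the tag of the atom they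 move, $\mathsf{Call}$ pushes $((n+1)@T_D,k)$, and $\mathsf{Ret}$ takes $pc$ (with its tag) and $\pi$ from the top frame. $\mathsf{Store}$ may write at any address; there is no $\mathsf{Output}$. Input data are $(p,args,n,T)$: the initial state runs program $p$ in user mode with $pc=0@T$, the list $args$ of atoms as stack, $\mu$ consisting of $n$ copies of $0@T$ at addresses $0,\dots,n-1$, and $\kappa$ consisting of the cache with an illegal opcode and all other payloads $T_D$. Events are atoms. **Rule table $\mathcal R^{\mathsf{abs}}$** (allowed if; label of the next pc; label of the result): add, sub, load: (true; $L_{pc}$; $L_1\sqcup L_2$); output: (true; $L_{pc}$; $L_1\sqcup L_{pc}$); push: (true; $L_{pc}$; $\bot$); store: ($L_1\sqcup L_{pc}\sqsubseteq L_3$; $L_{pc}$; $L_1\sqcup L_2\sqcup L_{pc}$); jump, bnz: (true; $L_1\sqcup L_{pc}$; $\bot$); call: (true; $L_1\sqcup L_{pc}$; $L_{pc}$); ret: (true; $L_1$; $\bot$). **Concrete lattice.** Let $\mathcal L$ be a partial order with binary joins $\vee$ and a least element $\bot$. A concrete lattice consists of $\mathsf{Tag}:\mathcal L\to\mathbb Z$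 and $\mathsf{Lab}:\mathbb Z\to\mathcal L$ with $\mathsf{Lab}\circ\mathsf{Tag}=\mathrm{id}$ and of instruction lists $\mathsf{genBot},\mathsf{genJoin},\mathsf{genFlows}$. It is *correct* if, placed anywhere in the kernel code and started in kernel mode at their first address with pc tag $T_D$, for any $\kappa,\mu,\sigma$ and any $L_1,L_2\in\mathcal L$, they run in kernel mode to the address just after them with pc tag $T_D$, leave $\kappa$ and $\mu$ unchanged, and change the stack as follows: $\mathsf{genBot}$: $[\sigma]\to[\mathsf{Tag}(\bot)@T_D,\sigma]$; $\mathsf{genJoin}$: $[\mathsf{Tag}(L_1)@T_D,\mathsf{Tag}(L_2)@T_D,\sigma]\to[\mathsf{Tag}(L_1\vee L_2)@T_D,\sigma]$; $\mathsf{genFlows}$: $[\mathsf{Tag}(L_1)@T_D,\mathsf{Tag}(L_2)@T_D,\sigma]\to[b@T_D,\sigma]$ with $b\neq0$ if and only if $L_1\le L_2$. **Fault handler $\phi_{\mathcal R^{\mathsf{abs}}}$.** This is the following code, stored from kernel address $0$ on. Write $\mathrm{if}(t,f)=[\mathsf{Bnz}(|f'|+1)]\,f'\,t$ with $f'=f\,[\mathsf{Push}\,1,\mathsf{Bnz}(|t|+1)]$,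 and $\mathrm{ld}(a)=[\mathsf{Push}\,a,\mathsf{Load}]$. A label expression is compiled by $\bot\mapsto\mathsf{genBot}$, $L_{pc},L_1,L_2,L_3\mapsto\mathrm{ld}(1),\dots,\mathrm{ld}(4)$, $e_1\sqcup e_2\mapsto[\![e_2]\!]\,[\![e_1]\!]\,\mathsf{genJoin}$; conditions by $\mathrm{true}\mapsto[\mathsf{Push}\,1]$, $e_1\sqsubseteq e_2\mapsto[\![e_2]\!]\,[\![e_1]\!]\,\mathsf{genFlows}$; a rule $(c;e;e')$ by $[\![c]\!]\ \mathrm{if}([\![e]\!]\,[\![e']\!]\,[\mathsf{Push}\,1],\,[\mathsf{Push}\,0])$. The handler is $D\ \ \mathrm{if}([\mathsf{Push}\,6,\mathsf{Store},\mathsf{Push}\,5,\mathsf{Store},\mathsf{Push}\,1],[\mathsf{Push}\,0])\ \ \mathrm{if}([\mathsf{Ret}],[\mathsf{Push}(-1),\mathsf{Jump}])$, where $D$ runs through the opcodes: $D$ is empty for the empty list, and for $op::ops$ it is $[\mathsf{Push}\,op]\ \mathrm{ld}(0)\ [\mathsf{Sub}]\ \mathrm{if}([\mathsf{Push}\,0],[\mathsf{Push}\,1])\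 \mathrm{if}(\text{rule of }op,\ D_{ops})$. **Observation.** The observers are the labels $o\in\mathcal L$; the event $n@T$ is observable by $o$ if $\mathsf{Lab}(T)\le o$; and $(p,args_1',n,\mathsf{Tag}(L))\approx_o(p,args_2',n,\mathsf{Tag}(L))$, for $L\in\mathcal L$, if $args_1',args_2'$ are obtained by applying $\mathsf{Tag}$ to the labels in two lists of the same length of labelled integers $n@L'$ ($L'\in\mathcal L$) which at each position are equal or both have labels $\not\le o$. (No other inputs are related.) **Theorem.** For every partial order $\mathcal L$ with binary joins and a least element, every $T_D\in\mathbb Z$ and every concrete lattice that is correct for $\mathcal L$, the concrete machine running the fault handler $\phi_{\mathcal R^{\mathsf{abs}}}$ satisfies TINI with respect to this notion of observation. -/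

import Mathlib

namespace IFC

/-! ## Generic machines, observations and noninterference -/

/-- A generic machine with states `S`, events `E` and input data `I`. An action is an `Option E`,
where `none` is the silent action `τ`. -/
structure Machine (S E I : Type*) where
  step : S → Option E → S → Prop
  start : I → S

/-- Reflexive-transitive closure of the step relation, collecting the events and omitting the
silent actions. -/
inductive Machine.Steps {S E I : Type*} (M : Machine S E I) : S → List E → S → Prop
  | refl (s : S) : Machine.Steps M s [] s
  | event {s₁ s₂ s₃ : S} {e : E} {t : List E} :
      M.step s₁ (some e) s₂ → Machine.Steps M s₂ t s₃ → Machine.Steps M s₁ (e :: t) s₃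
  | silent {s₁ s₂ s₃ : S} {t : List E} :
      M.step s₁ none s₂ → Machine.Steps M s₂ t s₃ → Machine.Steps M s₁ t s₃

/-- Some execution from `s` produces the trace `t`. -/
def Machine.Produces {S E I : Type*} (M : Machine S E I) (s : S) (t : List E) : Prop :=
  ∃ s', M.Steps s t s'

/-- A notion of observation with observers `Ω`: which events an observer sees, and which input
data an observer cannot distinguish. -/
structure Observation (E I Ω : Type*) where
  observable : Ω → E → Prop
  indist : Ω → I → I → Prop

open Classical in
/-- Remove the events that `o` does not observe from a trace. -/
noncomputable def Observation.filterTrace {E I Ω : Type*} (O : Observation E I Ω) (o : Ω)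
    (t : List E) : List E :=
  t.filter fun e => decide (O.observable o e)

/-- Indistinguishability of traces: equality after truncating the longer one. -/
inductive TraceIndist {E : Type*} : List E → List E → Prop
  | nil_left (t : List E) : TraceIndist [] t
  | nil_right (t : List E) : TraceIndist t []
  | cons (e : E) {t₁ t₂ : List E} : TraceIndist t₁ t₂ → TraceIndist (e :: t₁) (e :: t₂)

/-- Termination-insensitive noninterference. -/
def Machine.TINI {S E I Ω : Type*} (M : Machine S E I) (O : Observation E I Ω) : Prop :=
  ∀ (o : Ω) (i₁ i₂ : I) (t₁ t₂ : List E), O.indist o i₁ i₂ →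
    M.Produces (M.start i₁) t₁ → M.Produces (M.start i₂) t₂ →
    TraceIndist (O.filterTrace o t₁) (O.filterTrace o t₂)

/-! ## Instructions, opcodes, atoms -/

/-- The instruction set. `sub` is needed by the code generators below; it is an ordinary
instruction, handled exactly like `add`. -/
inductive Instr
  | add
  | sub
  | output
  | push (m : ℤ)
  | load
  | store
  | jump
  | bnz (k : ℤ)
  | call
  | ret

inductive Opcode
  | add
  | output
  | sub
  | push
  | load
  | store
  | jump
  | bnz
  | call
  | ret

/-- The integer that represents an opcode in the rule cache. -/
def Opcode.code : Opcode → ℤ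
  | .add => 0
  | .output => 1
  | .sub => 2
  | .push => 3
  | .load => 4
  | .store => 5
  | .jump => 6
  | .bnz => 7
  | .call => 8
  | .ret => 9

/-- An integer that represents no opcode. -/
def illegalOpcode : ℤ := -1

/-- The list of all opcodes. -/
def opcodes : List Opcode :=
  [.add, .output, .sub, .push, .load, .store, .jump, .bnz, .call, .ret]

/-- An integer payload with a label (`α` a label lattice) or with a concrete tag (`α = ℤ`). -/
structure Atom (α : Type*) where
  val : ℤ
  tag : α

abbrev CAtom := Atom ℤ

/-- Instruction memories: partial functions on non-negative addresses. -/
abbrev InstrMem := ℕ → Option Instr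

/-- The instruction at an integer address; there is none at a negative address. -/
def fetch (m : InstrMem) : ℤ → Option Instr
  | .ofNat n => m n
  | .negSucc _ => none

/-- Data memories: partial functions from integer addresses to atoms. -/
abbrev Mem := ℤ → Option CAtom

/-- The memory that agrees with `m` except at `p`, where its value is `a`. -/
def Mem.write (m : Mem) (p : ℤ) (a : CAtom) : Mem := Function.update m p (some a)

/-! ## The concrete machine -/

inductive Priv
  | user
  | kernel

/-- A stack element is an atom or a return frame, which holds a program counter and a privilege
bit. -/
inductive StackElt
  | data (a : CAtom)
  | frame (pc : CAtom) (π : Priv)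

abbrev Stack := List StackElt

structure CState where
  priv : Priv
  kmem : Mem
  mem : Mem
  stack : Stack
  pc : CAtom

/-! The rule cache occupies the first seven cells of kernel memory. -/

def addrOp : ℤ := 0
def addrTagPC : ℤ := 1
def addrTag1 : ℤ := 2
def addrTag2 : ℤ := 3
def addrTag3 : ℤ := 4
def addrTagRPC : ℤ := 5
def addrTagR : ℤ := 6

/-- The input part of a rule cache line. -/
structure CacheIn where
  op : ℤ
  tpc : ℤ
  t1 : ℤ
  t2 : ℤ
  t3 : ℤ

/-- The integer payload stored at address `p`. -/
def payload (κ : Mem) (p : ℤ) : Option ℤ := (κ p).map Atom.val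

/-- The input part of the cache in `κ` is `i`. -/
def CacheInputIs (κ : Mem) (i : CacheIn) : Prop :=
  payload κ addrOp = some i.op ∧ payload κ addrTagPC = some i.tpc ∧
    payload κ addrTag1 = some i.t1 ∧ payload κ addrTag2 = some i.t2 ∧
    payload κ addrTag3 = some i.t3

/-- The output part of the cache in `κ` consists of `trpc` and `tr`. -/
def CacheOutputIs (κ : Mem) (trpc tr : ℤ) : Prop :=
  payload κ addrTagRPC = some trpc ∧ payload κ addrTagR = some tr

/-- The cache in `κ` has input part `i` and output part `trpc`, `tr`. -/
def CacheHit (κ : Mem) (i : CacheIn) (trpc tr : ℤ) : Prop :=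
  CacheInputIs κ i ∧ CacheOutputIs κ trpc tr

/-- Set the input part of the cache to `i` and both cells of its output part to the default tag
`TD`; all cells written carry the tag `TD`. -/
def setCache (TD : ℤ) (κ : Mem) (i : CacheIn) : Mem :=
  ((((((κ.write addrOp ⟨i.op, TD⟩).write addrTagPC ⟨i.tpc, TD⟩).write addrTag1 ⟨i.t1, TD⟩).write
    addrTag2 ⟨i.t2, TD⟩).write addrTag3 ⟨i.t3, TD⟩).write addrTagRPC ⟨TD, TD⟩).write
      addrTagR ⟨TD, TD⟩

/-- The state reached by a cache miss: the cache input is loaded, the default tags are put in the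
cache output, and the fault handler at kernel address `0` is called. -/
def faultState (TD : ℤ) (κ μ : Mem) (σ : Stack) (pc : CAtom) (i : CacheIn) : CState :=
  ⟨.kernel, setCache TD κ i, μ, .frame pc .user :: σ, ⟨0, TD⟩⟩

open StackElt in
/-- The step relation of the concrete machine with default tag `TD`, user instruction memory `ι`
and kernel instruction memory `φ`. -/
inductive CStep (TD : ℤ) (ι φ : InstrMem) : CState → Option CAtom → CState → Prop
  -- user mode, cache hit
  | add {κ μ σ n tpc n₁ t₁ n₂ t₂ trpc tr} :
      fetch ι n = some .add → CacheHit κ ⟨Opcode.add.code, tpc, t₁, t₂, TD⟩ trpc tr →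
      CStep TD ι φ ⟨.user, κ, μ, data ⟨n₁, t₁⟩ :: data ⟨n₂, t₂⟩ :: σ, ⟨n, tpc⟩⟩ none
        ⟨.user, κ, μ, data ⟨n₁ + n₂, tr⟩ :: σ, ⟨n + 1, trpc⟩⟩
  | sub {κ μ σ n tpc n₁ t₁ n₂ t₂ trpc tr} :
      fetch ι n = some .sub → CacheHit κ ⟨Opcode.sub.code, tpc, t₁, t₂, TD⟩ trpc tr →
      CStep TD ι φ ⟨.user, κ, μ, data ⟨n₁, t₁⟩ :: data ⟨n₂, t₂⟩ :: σ, ⟨n, tpc⟩⟩ none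
        ⟨.user, κ, μ, data ⟨n₁ - n₂, tr⟩ :: σ, ⟨n + 1, trpc⟩⟩
  | output {κ μ σ n tpc m t₁ trpc tr} :
      fetch ι n = some .output → CacheHit κ ⟨Opcode.output.code, tpc, t₁, TD, TD⟩ trpc tr →
      CStep TD ι φ ⟨.user, κ, μ, data ⟨m, t₁⟩ :: σ, ⟨n, tpc⟩⟩ (some ⟨m, tr⟩)
        ⟨.user, κ, μ, σ, ⟨n + 1, trpc⟩⟩
  | push {κ μ σ n tpc m trpc tr} :
      fetch ι n = some (.push m) → CacheHit κ ⟨Opcode.push.code, tpc, TD, TD, TD⟩ trpc tr →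
      CStep TD ι φ ⟨.user, κ, μ, σ, ⟨n, tpc⟩⟩ none
        ⟨.user, κ, μ, data ⟨m, tr⟩ :: σ, ⟨n + 1, trpc⟩⟩
  | load {κ μ : Mem} {σ n tpc p t₁ m t₂ trpc tr} :
      fetch ι n = some .load → μ p = some ⟨m, t₂⟩ →
      CacheHit κ ⟨Opcode.load.code, tpc, t₁, t₂, TD⟩ trpc tr →
      CStep TD ι φ ⟨.user, κ, μ, data ⟨p, t₁⟩ :: σ, ⟨n, tpc⟩⟩ none
        ⟨.user, κ, μ, data ⟨m, tr⟩ :: σ, ⟨n + 1, trpc⟩⟩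
  | store {κ μ : Mem} {σ n tpc p t₁ m t₂ k t₃ trpc tr} :
      fetch ι n = some .store → μ p = some ⟨k, t₃⟩ →
      CacheHit κ ⟨Opcode.store.code, tpc, t₁, t₂, t₃⟩ trpc tr →
      CStep TD ι φ ⟨.user, κ, μ, data ⟨p, t₁⟩ :: data ⟨m, t₂⟩ :: σ, ⟨n, tpc⟩⟩ none
        ⟨.user, κ, μ.write p ⟨m, tr⟩, σ, ⟨n + 1, trpc⟩⟩
  | jump {κ μ σ n tpc n' t₁ trpc tr} :
      fetch ι n = some .jump → CacheHit κ ⟨Opcode.jump.code, tpc, t₁, TD, TD⟩ trpc tr →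
      CStep TD ι φ ⟨.user, κ, μ, data ⟨n', t₁⟩ :: σ, ⟨n, tpc⟩⟩ none
        ⟨.user, κ, μ, σ, ⟨n', trpc⟩⟩
  | bnz {κ μ σ n tpc k m t₁ trpc tr} :
      fetch ι n = some (.bnz k) → CacheHit κ ⟨Opcode.bnz.code, tpc, t₁, TD, TD⟩ trpc tr →
      CStep TD ι φ ⟨.user, κ, μ, data ⟨m, t₁⟩ :: σ, ⟨n, tpc⟩⟩ none
        ⟨.user, κ, μ, σ, ⟨n + (if m = 0 then 1 else k), trpc⟩⟩
  | call {κ μ σ n tpc n' t₁ a trpc tr} :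
      fetch ι n = some .call → CacheHit κ ⟨Opcode.call.code, tpc, t₁, TD, TD⟩ trpc tr →
      CStep TD ι φ ⟨.user, κ, μ, data ⟨n', t₁⟩ :: data a :: σ, ⟨n, tpc⟩⟩ none
        ⟨.user, κ, μ, data a :: frame ⟨n + 1, tr⟩ .user :: σ, ⟨n', trpc⟩⟩
  | ret {κ μ σ n tpc n' t₁ trpc tr} :
      fetch ι n = some .ret → CacheHit κ ⟨Opcode.ret.code, tpc, t₁, TD, TD⟩ trpc tr →
      CStep TD ι φ ⟨.user, κ, μ, frame ⟨n', t₁⟩ .user :: σ, ⟨n, tpc⟩⟩ none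
        ⟨.user, κ, μ, σ, ⟨n', trpc⟩⟩
  -- user mode, cache miss
  | addMiss {κ μ σ n tpc n₁ t₁ n₂ t₂} :
      fetch ι n = some .add → ¬ CacheInputIs κ ⟨Opcode.add.code, tpc, t₁, t₂, TD⟩ →
      CStep TD ι φ ⟨.user, κ, μ, data ⟨n₁, t₁⟩ :: data ⟨n₂, t₂⟩ :: σ, ⟨n, tpc⟩⟩ none
        (faultState TD κ μ (data ⟨n₁, t₁⟩ :: data ⟨n₂, t₂⟩ :: σ) ⟨n, tpc⟩
          ⟨Opcode.add.code, tpc, t₁, t₂, TD⟩)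
  | subMiss {κ μ σ n tpc n₁ t₁ n₂ t₂} :
      fetch ι n = some .sub → ¬ CacheInputIs κ ⟨Opcode.sub.code, tpc, t₁, t₂, TD⟩ →
      CStep TD ι φ ⟨.user, κ, μ, data ⟨n₁, t₁⟩ :: data ⟨n₂, t₂⟩ :: σ, ⟨n, tpc⟩⟩ none
        (faultState TD κ μ (data ⟨n₁, t₁⟩ :: data ⟨n₂, t₂⟩ :: σ) ⟨n, tpc⟩
          ⟨Opcode.sub.code, tpc, t₁, t₂, TD⟩)
  | outputMiss {κ μ σ n tpc m t₁} :
      fetch ι n = some .output → ¬ CacheInputIs κ ⟨Opcode.output.code, tpc, t₁, TD, TD⟩ →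
      CStep TD ι φ ⟨.user, κ, μ, data ⟨m, t₁⟩ :: σ, ⟨n, tpc⟩⟩ none
        (faultState TD κ μ (data ⟨m, t₁⟩ :: σ) ⟨n, tpc⟩
          ⟨Opcode.output.code, tpc, t₁, TD, TD⟩)
  | pushMiss {κ μ σ n tpc m} :
      fetch ι n = some (.push m) → ¬ CacheInputIs κ ⟨Opcode.push.code, tpc, TD, TD, TD⟩ →
      CStep TD ι φ ⟨.user, κ, μ, σ, ⟨n, tpc⟩⟩ none
        (faultState TD κ μ σ ⟨n, tpc⟩ ⟨Opcode.push.code, tpc, TD, TD, TD⟩)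
  | loadMiss {κ μ : Mem} {σ n tpc p t₁ m t₂} :
      fetch ι n = some .load → μ p = some ⟨m, t₂⟩ →
      ¬ CacheInputIs κ ⟨Opcode.load.code, tpc, t₁, t₂, TD⟩ →
      CStep TD ι φ ⟨.user, κ, μ, data ⟨p, t₁⟩ :: σ, ⟨n, tpc⟩⟩ none
        (faultState TD κ μ (data ⟨p, t₁⟩ :: σ) ⟨n, tpc⟩
          ⟨Opcode.load.code, tpc, t₁, t₂, TD⟩)
  | storeMiss {κ μ : Mem} {σ n tpc p t₁ m t₂ k t₃} :
      fetch ι n = some .store → μ p = some ⟨k, t₃⟩ →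
      ¬ CacheInputIs κ ⟨Opcode.store.code, tpc, t₁, t₂, t₃⟩ →
      CStep TD ι φ ⟨.user, κ, μ, data ⟨p, t₁⟩ :: data ⟨m, t₂⟩ :: σ, ⟨n, tpc⟩⟩ none
        (faultState TD κ μ (data ⟨p, t₁⟩ :: data ⟨m, t₂⟩ :: σ) ⟨n, tpc⟩
          ⟨Opcode.store.code, tpc, t₁, t₂, t₃⟩)
  | jumpMiss {κ μ σ n tpc n' t₁} :
      fetch ι n = some .jump → ¬ CacheInputIs κ ⟨Opcode.jump.code, tpc, t₁, TD, TD⟩ →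
      CStep TD ι φ ⟨.user, κ, μ, data ⟨n', t₁⟩ :: σ, ⟨n, tpc⟩⟩ none
        (faultState TD κ μ (data ⟨n', t₁⟩ :: σ) ⟨n, tpc⟩
          ⟨Opcode.jump.code, tpc, t₁, TD, TD⟩)
  | bnzMiss {κ μ σ n tpc k m t₁} :
      fetch ι n = some (.bnz k) → ¬ CacheInputIs κ ⟨Opcode.bnz.code, tpc, t₁, TD, TD⟩ →
      CStep TD ι φ ⟨.user, κ, μ, data ⟨m, t₁⟩ :: σ, ⟨n, tpc⟩⟩ none
        (faultState TD κ μ (data ⟨m, t₁⟩ :: σ) ⟨n, tpc⟩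
          ⟨Opcode.bnz.code, tpc, t₁, TD, TD⟩)
  | callMiss {κ μ σ n tpc n' t₁ a} :
      fetch ι n = some .call → ¬ CacheInputIs κ ⟨Opcode.call.code, tpc, t₁, TD, TD⟩ →
      CStep TD ι φ ⟨.user, κ, μ, data ⟨n', t₁⟩ :: data a :: σ, ⟨n, tpc⟩⟩ none
        (faultState TD κ μ (data ⟨n', t₁⟩ :: data a :: σ) ⟨n, tpc⟩
          ⟨Opcode.call.code, tpc, t₁, TD, TD⟩)
  | retMiss {κ μ σ n tpc n' t₁} :
      fetch ι n = some .ret → ¬ CacheInputIs κ ⟨Opcode.ret.code, tpc, t₁, TD, TD⟩ →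
      CStep TD ι φ ⟨.user, κ, μ, frame ⟨n', t₁⟩ .user :: σ, ⟨n, tpc⟩⟩ none
        (faultState TD κ μ (frame ⟨n', t₁⟩ .user :: σ) ⟨n, tpc⟩
          ⟨Opcode.ret.code, tpc, t₁, TD, TD⟩)
  -- kernel mode: tags are ignored, the cache is not consulted, there is no output
  | addK {κ μ σ n tpc n₁ t₁ n₂ t₂} :
      fetch φ n = some .add →
      CStep TD ι φ ⟨.kernel, κ, μ, data ⟨n₁, t₁⟩ :: data ⟨n₂, t₂⟩ :: σ, ⟨n, tpc⟩⟩ none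
        ⟨.kernel, κ, μ, data ⟨n₁ + n₂, TD⟩ :: σ, ⟨n + 1, TD⟩⟩
  | subK {κ μ σ n tpc n₁ t₁ n₂ t₂} :
      fetch φ n = some .sub →
      CStep TD ι φ ⟨.kernel, κ, μ, data ⟨n₁, t₁⟩ :: data ⟨n₂, t₂⟩ :: σ, ⟨n, tpc⟩⟩ none
        ⟨.kernel, κ, μ, data ⟨n₁ - n₂, TD⟩ :: σ, ⟨n + 1, TD⟩⟩
  | pushK {κ μ σ n tpc m} :
      fetch φ n = some (.push m) →
      CStep TD ι φ ⟨.kernel, κ, μ, σ, ⟨n, tpc⟩⟩ none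
        ⟨.kernel, κ, μ, data ⟨m, TD⟩ :: σ, ⟨n + 1, TD⟩⟩
  | loadK {κ μ : Mem} {σ n tpc p t₁ a} :
      fetch φ n = some .load → κ p = some a →
      CStep TD ι φ ⟨.kernel, κ, μ, data ⟨p, t₁⟩ :: σ, ⟨n, tpc⟩⟩ none
        ⟨.kernel, κ, μ, data a :: σ, ⟨n + 1, TD⟩⟩
  | storeK {κ μ : Mem} {σ n tpc p t₁ a} :
      fetch φ n = some .store →
      CStep TD ι φ ⟨.kernel, κ, μ, data ⟨p, t₁⟩ :: data a :: σ, ⟨n, tpc⟩⟩ none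
        ⟨.kernel, κ.write p a, μ, σ, ⟨n + 1, TD⟩⟩
  | jumpK {κ μ σ n tpc n' t₁} :
      fetch φ n = some .jump →
      CStep TD ι φ ⟨.kernel, κ, μ, data ⟨n', t₁⟩ :: σ, ⟨n, tpc⟩⟩ none
        ⟨.kernel, κ, μ, σ, ⟨n', TD⟩⟩
  | bnzK {κ μ σ n tpc k m t₁} :
      fetch φ n = some (.bnz k) →
      CStep TD ι φ ⟨.kernel, κ, μ, data ⟨m, t₁⟩ :: σ, ⟨n, tpc⟩⟩ none
        ⟨.kernel, κ, μ, σ, ⟨n + (if m = 0 then 1 else k), TD⟩⟩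
  | callK {κ μ σ n tpc n' t₁ a} :
      fetch φ n = some .call →
      CStep TD ι φ ⟨.kernel, κ, μ, data ⟨n', t₁⟩ :: data a :: σ, ⟨n, tpc⟩⟩ none
        ⟨.kernel, κ, μ, data a :: frame ⟨n + 1, TD⟩ .kernel :: σ, ⟨n', TD⟩⟩
  | retK {κ μ σ n tpc pc' π} :
      fetch φ n = some .ret →
      CStep TD ι φ ⟨.kernel, κ, μ, frame pc' π :: σ, ⟨n, tpc⟩⟩ none
        ⟨π, κ, μ, σ, pc'⟩

/-- Input data of the concrete machine: a program, the atoms on the initial stack, the size of the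
data memory, and the tag on the initial memory cells and the initial program counter. -/
structure CInput where
  prog : InstrMem
  args : List CAtom
  size : ℕ
  tag : ℤ

/-- The data memory that holds `n` copies of `0` with tag `T`, at the addresses `0, …, n - 1`. -/
def initMem (n : ℕ) (T : ℤ) : Mem := fun p => if 0 ≤ p ∧ p < n then some ⟨0, T⟩ else none

/-- The initial kernel memory: just the rule cache, with an illegal opcode. -/
def initKMem (TD : ℤ) : Mem := setCache TD (fun _ => none) ⟨illegalOpcode, TD, TD, TD, TD⟩

/-- The initial state: user mode, program counter `0`. -/
def initCState (TD : ℤ) (i : CInput) : CState :=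
  ⟨.user, initKMem TD, initMem i.size i.tag, i.args.map .data, ⟨0, i.tag⟩⟩

/-- The concrete machine, with default tag `TD` and kernel code `φ`, as a generic machine. Its
states carry the user program, which never changes. -/
def concreteMachine (TD : ℤ) (φ : InstrMem) : Machine (InstrMem × CState) CAtom CInput where
  step s α s' := s'.1 = s.1 ∧ CStep TD s.1 φ s.2 α s'.2
  start i := (i.prog, initCState TD i)

/-! ## Symbolic IFC rules -/

/-- Label-valued expressions. -/
inductive LExpr
  | bot
  | labPC
  | lab1
  | lab2
  | lab3
  | join (e₁ e₂ : LExpr)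

/-- Boolean-valued expressions. -/
inductive BExpr
  | tru
  | flows (e₁ e₂ : LExpr)
  | and (b₁ b₂ : BExpr)
  | or (b₁ b₂ : BExpr)

/-- A symbolic rule: whether the instruction is allowed, the label of the next program counter and
the label of the result. -/
structure Rule where
  allow : BExpr
  erpc : LExpr
  er : LExpr

abbrev RuleTable := Opcode → Rule

/-- The rule table of the abstract IFC machine; `LExpr.bot` also stands for "don't care". -/
def rulesAbs : RuleTable
  | .add => ⟨.tru, .labPC, .join .lab1 .lab2⟩
  | .sub => ⟨.tru, .labPC, .join .lab1 .lab2⟩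
  | .output => ⟨.tru, .labPC, .join .lab1 .labPC⟩
  | .push => ⟨.tru, .labPC, .bot⟩
  | .load => ⟨.tru, .labPC, .join .lab1 .lab2⟩
  | .store => ⟨.flows (.join .lab1 .labPC) .lab3, .labPC, .join (.join .lab1 .lab2) .labPC⟩
  | .jump => ⟨.tru, .join .lab1 .labPC, .bot⟩
  | .bnz => ⟨.tru, .join .lab1 .labPC, .bot⟩
  | .call => ⟨.tru, .join .lab1 .labPC, .labPC⟩
  | .ret => ⟨.tru, .lab1, .bot⟩

/-! ## Concrete lattices -/

abbrev Code := List Instr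

/-- A concrete lattice: an encoding of labels as integer tags, and code for the lattice
operations. -/
structure ConcreteLattice (L : Type*) where
  Tag : L → ℤ
  Lab : ℤ → L
  lab_tag : ∀ l, Lab (Tag l) = l
  genBot : Code
  genJoin : Code
  genFlows : Code

/-! ## The fault handler generator -/

def genTrue : Code := [.push 1]

def genFalse : Code := [.push 0]

def genPop : Code := [.bnz 1]

def genLoadFrom (p : ℤ) : Code := [.push p, .load]

def genStoreAt (p : ℤ) : Code := [.push p, .store]

def genSkipIf (n : ℕ) : Code := [.bnz (n + 1)]

def genSkip (n : ℕ) : Code := genTrue ++ genSkipIf n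

/-- Test (and pop) the top of the stack; run `t` if it is non-zero and `f` otherwise. -/
def genIf (t f : Code) : Code :=
  let f' := f ++ genSkip t.length
  genSkipIf f'.length ++ f' ++ t

def genNot : Code := genIf genFalse genTrue

def genAnd : Code := genIf [] (genPop ++ genFalse)

def genOr : Code := genIf (genPop ++ genTrue) []

def genEqual : Code := [.sub] ++ genNot

def genSome (c : Code) : Code := c ++ genTrue

def genNone : Code := genFalse

def genIndexedCases {α : Type*} (genDefault : Code) (genGuard genBody : α → Code) :
    List α → Code
  | [] => genDefault
  | n :: ns => genGuard n ++ genIf (genBody n) (genIndexedCases genDefault genGuard genBody ns)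

def genMatchOp (op : Opcode) : Code := [.push op.code] ++ genLoadFrom addrOp ++ genEqual

section Generator

variable {L : Type*} (CL : ConcreteLattice L)

def genELab : LExpr → Code
  | .bot => CL.genBot
  | .labPC => genLoadFrom addrTagPC
  | .lab1 => genLoadFrom addrTag1
  | .lab2 => genLoadFrom addrTag2
  | .lab3 => genLoadFrom addrTag3
  | .join e₁ e₂ => genELab e₂ ++ genELab e₁ ++ CL.genJoin

def genBool : BExpr → Code
  | .tru => genTrue
  | .flows e₁ e₂ => genELab CL e₂ ++ genELab CL e₁ ++ CL.genFlows
  | .and b₁ b₂ => genBool b₂ ++ genBool b₁ ++ genAnd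
  | .or b₁ b₂ => genBool b₂ ++ genBool b₁ ++ genOr

def genApplyRule (r : Rule) : Code :=
  genBool CL r.allow ++ genIf (genSome (genELab CL r.erpc ++ genELab CL r.er)) genNone

def genComputeResults (R : RuleTable) : Code :=
  genIndexedCases [] genMatchOp (fun op => genApplyRule CL (R op)) opcodes

def genStoreResults : Code :=
  genIf (genStoreAt addrTagR ++ genStoreAt addrTagRPC ++ genTrue) genFalse

def genFaultHandler (R : RuleTable) : Code :=
  genComputeResults CL R ++ genStoreResults ++ genIf [.ret] [.push (-1), .jump]

end Generator

/-- The instruction memory that holds `code` from address `0` on, and nothing else. -/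
def loadCode (code : Code) : InstrMem := fun n => code[n]?

/-! ## Correctness of a concrete lattice -/

/-- Zero or more steps of the concrete machine, such that all states but possibly the last are in
kernel mode. -/
def KernelSteps (TD : ℤ) (ι φ : InstrMem) : CState → CState → Prop :=
  Relation.ReflTransGen fun s s' => s.priv = .kernel ∧ CStep TD ι φ s none s'

/-- The list `code` is stored in `φ` from address `n` on. -/
def CodeAt (φ : InstrMem) (n : ℕ) (code : Code) : Prop :=
  ∀ i (h : i < code.length), φ (n + i) = some code[i]

/-- The (total correctness) Hoare triple for self-contained code: wherever `c` is stored in the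
kernel instruction memory, from any kernel memory and stack satisfying `P` the machine runs in
kernel mode to the address just after `c`, with kernel memory and stack satisfying `Q`. -/
def Triple (TD : ℤ) (P : Mem → Stack → Prop) (c : Code) (Q : Mem → Stack → Prop) : Prop :=
  ∀ (ι φ : InstrMem) (n : ℕ) (κ μ : Mem) (σ : Stack), CodeAt φ n c → P κ σ →
    ∃ κ' σ', Q κ' σ' ∧
      KernelSteps TD ι φ ⟨.kernel, κ, μ, σ, ⟨n, TD⟩⟩
        ⟨.kernel, κ', μ, σ', ⟨(n + c.length : ℕ), TD⟩⟩

open StackElt in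
/-- The concrete lattice is a correct encoding of the lattice `L`: its code meets the
specifications, in weakest-precondition style, of the lattice operations. As a boolean, `0` is
false and every other integer is true. -/
structure ConcreteLattice.Correct {L : Type*} [SemilatticeSup L] [OrderBot L]
    (CL : ConcreteLattice L) (TD : ℤ) : Prop where
  bot : ∀ Q : Mem → Stack → Prop,
    Triple TD (fun κ σ => Q κ (data ⟨CL.Tag ⊥, TD⟩ :: σ)) CL.genBot Q
  join : ∀ Q : Mem → Stack → Prop,
    Triple TD (fun κ σ => ∃ (l₁ l₂ : L) (σ' : Stack),
        σ = data ⟨CL.Tag l₁, TD⟩ :: data ⟨CL.Tag l₂, TD⟩ :: σ' ∧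
          Q κ (data ⟨CL.Tag (l₁ ⊔ l₂), TD⟩ :: σ')) CL.genJoin Q
  flows : ∀ Q : Mem → Stack → Prop,
    Triple TD (fun κ σ => ∃ (l₁ l₂ : L) (σ' : Stack),
        σ = data ⟨CL.Tag l₁, TD⟩ :: data ⟨CL.Tag l₂, TD⟩ :: σ' ∧
          ∀ b : ℤ, (b ≠ 0 ↔ l₁ ≤ l₂) → Q κ (data ⟨b, TD⟩ :: σ')) CL.genFlows Q

/-! ## Observation of the concrete machine -/

/-- Two labelled atoms are indistinguishable to `o` if they are equal or neither is observable. -/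
def AtomIndist {L : Type*} [LE L] (o : L) (a₁ a₂ : Atom L) : Prop :=
  a₁ = a₂ ∨ (¬ a₁.tag ≤ o ∧ ¬ a₂.tag ≤ o)

/-- Encode the label of an atom as a tag. -/
def ConcreteLattice.encode {L : Type*} (CL : ConcreteLattice L) (a : Atom L) : CAtom :=
  ⟨a.val, CL.Tag a.tag⟩

/-- Indistinguishability of input data: same program, same memory size, same encoded initial
label, and initial stacks that encode pairwise indistinguishable labelled atoms. -/
inductive InputIndist {L : Type*} [LE L] (CL : ConcreteLattice L) (o : L) :
    CInput → CInput → Prop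
  | mk (p : InstrMem) (args₁ args₂ : List (Atom L)) (n : ℕ) (l : L) :
      List.Forall₂ (AtomIndist o) args₁ args₂ →
      InputIndist CL o ⟨p, args₁.map CL.encode, n, CL.Tag l⟩ ⟨p, args₂.map CL.encode, n, CL.Tag l⟩

/-- The notion of observation for the concrete machine; the observers are the labels. -/
def concreteObservation {L : Type*} [LE L] (CL : ConcreteLattice L) :
    Observation CAtom CInput L where
  observable o e := CL.Lab e.tag ≤ o
  indist := InputIndist CL

end IFC

namespace IFC

/-! ## Runs of a generic machine -/

/-! The proof separates information flow from kernel code by means of a user-level machine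
(`userMachine`). Its states have no cache and no kernel mode, and its result tags come directly from
the rule table. TINI quantifies over all traces, so two facts suffice: every concrete trace is a
trace of the user-level machine (`produces_userMachine`), and the user-level machine is
noninterfering (`userMachine_traceIndist`).

Noninterference is an unwinding argument. Related states have pointwise indistinguishable memories.
In addition, either they share an observable pc and have pointwise indistinguishable stacks, or both
pcs are unobservable and only the stacks from the topmost observable return frame on are related.
Data above that frame must be ignored: `Push`, `Add`, `Sub` and `Load` do not raise labels to that
of the pc, so secret-dependent code can leave atoms with low labels there. From an observable pc the
two runs move in lockstep (`UserStep.of_low`). From an unobservable one, a step either changes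
nothing visible or returns to the topmost observable frame (`UserStep.of_high`). Such steps are
taken on one side at a time until both sides return to the same place. If one run ends first,
truncation of the traces settles the comparison.

For the simulation, two invariants hold in user mode: every tag encodes a label, and every cache hit
on a legal opcode agrees with the rule table. A hit is then a user-level step. A miss runs the fault
handler, which restores the user state with a valid cache or halts for good (`faultHandler_correct`,
proved by Hoare triples over the code generators). Kernel mode is silent and deterministic, so the
actual run follows the one that the triples provide. -/

/-- Induction on executions that treats events and silent actions uniformly. -/
theorem Machine.Steps.uniform_induction {S E I : Type*} {M : Machine S E I}
    {motive : S → List E → Prop} (refl : ∀ s, motive s [])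
    (step : ∀ s α s' t s'', M.step s α s' → M.Steps s' t s'' → motive s' t →
      motive s (α.toList ++ t))
    {s s' : S} {t : List E} (h : M.Steps s t s') : motive s t := by
  induction h with
  | refl s => exact refl s
  | event h₁ h₂ ih => exact step _ (some _) _ _ _ h₁ h₂ ih
  | silent h₁ h₂ ih => exact step _ none _ _ _ h₁ h₂ ih

theorem Machine.Produces.cons {S E I : Type*} {M : Machine S E I} {s s' : S} {α : Option E}
    {t : List E} (h : M.step s α s') (ht : M.Produces s' t) : M.Produces s (α.toList ++ t) := by
  obtain ⟨s'', hs⟩ := ht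
  cases α with
  | none => exact ⟨s'', .silent h hs⟩
  | some e => exact ⟨s'', .event h hs⟩

theorem TraceIndist.append {E : Type*} (t : List E) {t₁ t₂ : List E} (h : TraceIndist t₁ t₂) :
    TraceIndist (t ++ t₁) (t ++ t₂) := by
  induction t with
  | nil => exact h
  | cons e t ih => exact .cons e ih

theorem Observation.filterTrace_append {E I Ω : Type*} (O : Observation E I Ω) (o : Ω)
    (t₁ t₂ : List E) :
    O.filterTrace o (t₁ ++ t₂) = O.filterTrace o t₁ ++ O.filterTrace o t₂ := by
  simp [Observation.filterTrace]

/-! ## Semantics of symbolic rules -/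

section Semantics

variable {L : Type*} [SemilatticeSup L] [OrderBot L] (CL : ConcreteLattice L)

/-- The value of a label expression on the labels denoted by the tags of a cache input. -/
def LExpr.eval (i : CacheIn) : LExpr → L
  | .bot => ⊥
  | .labPC => CL.Lab i.tpc
  | .lab1 => CL.Lab i.t1
  | .lab2 => CL.Lab i.t2
  | .lab3 => CL.Lab i.t3
  | .join e₁ e₂ => e₁.eval i ⊔ e₂.eval i

/-- The truth of a boolean expression on the labels denoted by the tags of a cache input. -/
def BExpr.Holds (i : CacheIn) : BExpr → Prop
  | .tru => True
  | .flows e₁ e₂ => e₁.eval CL i ≤ e₂.eval CL i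
  | .and b₁ b₂ => b₁.Holds i ∧ b₂.Holds i
  | .or b₁ b₂ => b₁.Holds i ∨ b₂.Holds i

theorem Opcode.code_injective : Function.Injective Opcode.code := by
  intro a b h
  cases a <;> cases b <;> first | rfl | (simp [Opcode.code] at h)

/-- The rule table allows the instruction with cache input `i` and yields the tags `trpc`, `tr`. -/
def RuleYields (i : CacheIn) (trpc tr : ℤ) : Prop :=
  ∃ op : Opcode, i.op = op.code ∧ (rulesAbs op).allow.Holds CL i ∧
    trpc = CL.Tag ((rulesAbs op).erpc.eval CL i) ∧ tr = CL.Tag ((rulesAbs op).er.eval CL i)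

/-- Distinct opcodes have distinct codes, so the opcode quantified in `RuleYields` is forced. This
lets `simp` evaluate the rule table in each case of `Effect`. -/
theorem ruleYields_code {op : Opcode} {tpc t₁ t₂ t₃ trpc tr : ℤ} :
    RuleYields CL ⟨op.code, tpc, t₁, t₂, t₃⟩ trpc tr ↔
      (rulesAbs op).allow.Holds CL ⟨op.code, tpc, t₁, t₂, t₃⟩ ∧
        trpc = CL.Tag ((rulesAbs op).erpc.eval CL ⟨op.code, tpc, t₁, t₂, t₃⟩) ∧
        tr = CL.Tag ((rulesAbs op).er.eval CL ⟨op.code, tpc, t₁, t₂, t₃⟩) := by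
  constructor
  · rintro ⟨op', h, h'⟩
    obtain rfl := Opcode.code_injective h
    exact h'
  · exact fun h => ⟨op, rfl, h⟩

end Semantics

/-! ## The user-level machine -/

/-- The part of the state that user code manipulates. -/
structure UState where
  mem : Mem
  stack : Stack
  pc : CAtom

/-- The state of the concrete machine in user mode with kernel memory `κ`. -/
def UState.withKernel (u : UState) (κ : Mem) : CState := ⟨.user, κ, u.mem, u.stack, u.pc⟩

open StackElt in
/-- `Effect TD trpc tr c u i α u'`: in the user state `u` the instruction `c` needs the cache input
`i`, and with cache output `trpc`, `tr` it leads to `u'` with action `α`. -/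
inductive Effect (TD trpc tr : ℤ) :
    Instr → UState → CacheIn → Option CAtom → UState → Prop
  | add {μ σ n tpc n₁ t₁ n₂ t₂} :
      Effect TD trpc tr .add ⟨μ, data ⟨n₁, t₁⟩ :: data ⟨n₂, t₂⟩ :: σ, ⟨n, tpc⟩⟩
        ⟨Opcode.add.code, tpc, t₁, t₂, TD⟩ none ⟨μ, data ⟨n₁ + n₂, tr⟩ :: σ, ⟨n + 1, trpc⟩⟩
  | sub {μ σ n tpc n₁ t₁ n₂ t₂} :
      Effect TD trpc tr .sub ⟨μ, data ⟨n₁, t₁⟩ :: data ⟨n₂, t₂⟩ :: σ, ⟨n, tpc⟩⟩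
        ⟨Opcode.sub.code, tpc, t₁, t₂, TD⟩ none ⟨μ, data ⟨n₁ - n₂, tr⟩ :: σ, ⟨n + 1, trpc⟩⟩
  | output {μ σ n tpc m t₁} :
      Effect TD trpc tr .output ⟨μ, data ⟨m, t₁⟩ :: σ, ⟨n, tpc⟩⟩
        ⟨Opcode.output.code, tpc, t₁, TD, TD⟩ (some ⟨m, tr⟩) ⟨μ, σ, ⟨n + 1, trpc⟩⟩
  | push {μ σ n tpc m} :
      Effect TD trpc tr (.push m) ⟨μ, σ, ⟨n, tpc⟩⟩
        ⟨Opcode.push.code, tpc, TD, TD, TD⟩ none ⟨μ, data ⟨m, tr⟩ :: σ, ⟨n + 1, trpc⟩⟩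
  | load {μ : Mem} {σ n tpc p t₁ m t₂} (hp : μ p = some ⟨m, t₂⟩) :
      Effect TD trpc tr .load ⟨μ, data ⟨p, t₁⟩ :: σ, ⟨n, tpc⟩⟩
        ⟨Opcode.load.code, tpc, t₁, t₂, TD⟩ none ⟨μ, data ⟨m, tr⟩ :: σ, ⟨n + 1, trpc⟩⟩
  | store {μ : Mem} {σ n tpc p t₁ m t₂ k t₃} (hp : μ p = some ⟨k, t₃⟩) :
      Effect TD trpc tr .store ⟨μ, data ⟨p, t₁⟩ :: data ⟨m, t₂⟩ :: σ, ⟨n, tpc⟩⟩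
        ⟨Opcode.store.code, tpc, t₁, t₂, t₃⟩ none ⟨μ.write p ⟨m, tr⟩, σ, ⟨n + 1, trpc⟩⟩
  | jump {μ σ n tpc n' t₁} :
      Effect TD trpc tr .jump ⟨μ, data ⟨n', t₁⟩ :: σ, ⟨n, tpc⟩⟩
        ⟨Opcode.jump.code, tpc, t₁, TD, TD⟩ none ⟨μ, σ, ⟨n', trpc⟩⟩
  | bnz {μ σ n tpc k m t₁} :
      Effect TD trpc tr (.bnz k) ⟨μ, data ⟨m, t₁⟩ :: σ, ⟨n, tpc⟩⟩
        ⟨Opcode.bnz.code, tpc, t₁, TD, TD⟩ none ⟨μ, σ, ⟨n + (if m = 0 then 1 else k), trpc⟩⟩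
  | call {μ σ n tpc n' t₁ a} :
      Effect TD trpc tr .call ⟨μ, data ⟨n', t₁⟩ :: data a :: σ, ⟨n, tpc⟩⟩
        ⟨Opcode.call.code, tpc, t₁, TD, TD⟩ none
        ⟨μ, data a :: frame ⟨n + 1, tr⟩ .user :: σ, ⟨n', trpc⟩⟩
  | ret {μ σ n tpc n' t₁} :
      Effect TD trpc tr .ret ⟨μ, frame ⟨n', t₁⟩ .user :: σ, ⟨n, tpc⟩⟩
        ⟨Opcode.ret.code, tpc, t₁, TD, TD⟩ none ⟨μ, σ, ⟨n', trpc⟩⟩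

section UserLevel

set_option linter.unusedSectionVars false

variable {L : Type*} [SemilatticeSup L] [OrderBot L] (CL : ConcreteLattice L)

/-- The step relation of user code when the result tags come straight from the rule table. -/
def UserStep (TD : ℤ) (ι : InstrMem) (u : UState) (α : Option CAtom) (u' : UState) : Prop :=
  ∃ c i trpc tr, fetch ι u.pc.val = some c ∧ RuleYields CL i trpc tr ∧
    Effect TD trpc tr c u i α (u' : UState)

/-- The user-level machine running the program `ι`; its input is the initial state. -/
def userMachine (TD : ℤ) (ι : InstrMem) : Machine UState CAtom UState where
  step := UserStep CL TD ι
  start := id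

/-! ## Indistinguishability of user states -/

variable (o : L)

/-- Two tagged atoms are equal, or neither is observable. -/
def CAtomIndist (a b : CAtom) : Prop := a = b ∨ (¬ CL.Lab a.tag ≤ o ∧ ¬ CL.Lab b.tag ≤ o)

inductive EltIndist : StackElt → StackElt → Prop
  | data {a b : CAtom} : CAtomIndist CL o a b → EltIndist (.data a) (.data b)
  | frame {a b : CAtom} {π : Priv} : CAtomIndist CL o a b → EltIndist (.frame a π) (.frame b π)

open Classical in
/-- The part of the stack from the topmost observable return frame on. -/
noncomputable def lowTail : Stack → Stack
  | [] => []
  | .data _ :: σ => lowTail σ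
  | .frame a π :: σ => if CL.Lab a.tag ≤ o then .frame a π :: σ else lowTail σ

/-- `Option.Rel` also forces equal domains. User steps preserve domains, because `Store` only
overwrites existing cells. -/
def MemIndist (μ₁ μ₂ : Mem) : Prop := ∀ p, Option.Rel (CAtomIndist CL o) (μ₁ p) (μ₂ p)

/-- Indistinguishability of user states. If the program counter is not observable, only the part of
the stack from the topmost observable return frame on matters. -/
def UState.Indist (u₁ u₂ : UState) : Prop :=
  MemIndist CL o u₁.mem u₂.mem ∧
    ((u₁.pc = u₂.pc ∧ CL.Lab u₁.pc.tag ≤ o ∧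
        List.Forall₂ (EltIndist CL o) u₁.stack u₂.stack) ∨
      (¬ CL.Lab u₁.pc.tag ≤ o ∧ ¬ CL.Lab u₂.pc.tag ≤ o ∧
        List.Forall₂ (EltIndist CL o) (lowTail CL o u₁.stack) (lowTail CL o u₂.stack)))

variable {CL o}

/-! ### Symmetry of indistinguishability, and steps from an unobservable program counter. -/

theorem CAtomIndist.symm {a b : CAtom} (h : CAtomIndist CL o a b) : CAtomIndist CL o b a :=
  h.elim (fun h => .inl h.symm) fun h => .inr ⟨h.2, h.1⟩

theorem EltIndist.symm {x y : StackElt} (h : EltIndist CL o x y) : EltIndist CL o y x := by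
  cases h with
  | data h => exact .data h.symm
  | frame h => exact .frame h.symm

theorem forall₂_eltIndist_symm {σ₁ σ₂ : Stack} (h : List.Forall₂ (EltIndist CL o) σ₁ σ₂) :
    List.Forall₂ (EltIndist CL o) σ₂ σ₁ := by
  induction h with
  | nil => exact .nil
  | cons h _ ih => exact .cons h.symm ih

theorem MemIndist.symm {μ₁ μ₂ : Mem} (h : MemIndist CL o μ₁ μ₂) : MemIndist CL o μ₂ μ₁ := by
  intro p
  have hp := h p
  revert hp
  generalize μ₁ p = x
  generalize μ₂ p = y
  rintro (h | _)
  · exact .some h.symm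
  · exact .none

theorem UState.Indist.symm {u₁ u₂ : UState} (h : u₁.Indist CL o u₂) : u₂.Indist CL o u₁ := by
  obtain ⟨hm, ⟨hpc, hl, hs⟩ | ⟨h₁, h₂, hs⟩⟩ := h
  · exact ⟨hm.symm, .inl ⟨hpc.symm, hpc ▸ hl, forall₂_eltIndist_symm hs⟩⟩
  · exact ⟨hm.symm, .inr ⟨h₂, h₁, forall₂_eltIndist_symm hs⟩⟩

/-- Matching frames are equal or both unobservable, so both searches stop at the same position. This
is what is needed when related runs move from an observable pc to unobservable ones. -/
theorem forall₂_lowTail {σ₁ σ₂ : Stack} (h : List.Forall₂ (EltIndist CL o) σ₁ σ₂) :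
    List.Forall₂ (EltIndist CL o) (lowTail CL o σ₁) (lowTail CL o σ₂) := by
  induction h with
  | nil => exact .nil
  | cons h hs ih =>
    cases h with
    | data h => exact ih
    | frame h =>
      rcases h with rfl | ⟨h₁, h₂⟩
      · simp only [lowTail]
        split
        · exact .cons (.frame (.inl rfl)) hs
        · exact ih
      · simpa [lowTail, h₁, h₂] using ih

/-- A memory that differs from `μ₁` only in cells that are unobservable before and after. -/
theorem MemIndist.of_high_writes {μ₁ μ₁' μ₂ : Mem} (h : MemIndist CL o μ₁ μ₂)
    (h' : ∀ p, μ₁' p = μ₁ p ∨ ∃ a b, μ₁ p = some a ∧ μ₁' p = some b ∧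
      ¬ CL.Lab a.tag ≤ o ∧ ¬ CL.Lab b.tag ≤ o) : MemIndist CL o μ₁' μ₂ := by
  intro p
  have hp := h p
  rcases h' p with h' | ⟨a, b, ha, hb, hla, hlb⟩
  · rwa [h']
  · rw [ha] at hp
    rw [hb]
    revert hp
    generalize μ₂ p = y
    rintro (h | _)
    rename_i c
    refine .some (.inr ⟨hlb, ?_⟩)
    rcases h with rfl | h
    · exact hla
    · exact h.2

/-- A step from an unobservable program counter either stays there, changing nothing observable, or
returns to the topmost observable return frame. -/
theorem UserStep.of_high {TD : ℤ} {ι : InstrMem} {u u' : UState} {α : Option CAtom}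
    (h : UserStep CL TD ι u α u') (hpc : ¬ CL.Lab u.pc.tag ≤ o) :
    (¬ CL.Lab u'.pc.tag ≤ o ∧ (∀ e ∈ α, ¬ CL.Lab e.tag ≤ o) ∧
        (∀ p, u'.mem p = u.mem p ∨ ∃ a b, u.mem p = some a ∧ u'.mem p = some b ∧
          ¬ CL.Lab a.tag ≤ o ∧ ¬ CL.Lab b.tag ≤ o) ∧
        lowTail CL o u'.stack = lowTail CL o u.stack) ∨
      (α = none ∧ u'.mem = u.mem ∧ ∃ n t, u'.pc = ⟨n, CL.Tag (CL.Lab t)⟩ ∧ CL.Lab t ≤ o ∧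
        lowTail CL o u.stack = .frame ⟨n, t⟩ .user :: u'.stack) := by
  obtain ⟨c, i, trpc, tr, -, hr, he⟩ := h
  cases he
  case ret μ σ n tpc n' t₁ =>
    simp only [ruleYields_code, rulesAbs, LExpr.eval] at hr
    obtain ⟨-, rfl, -⟩ := hr
    by_cases ht : CL.Lab t₁ ≤ o
    · exact .inr ⟨rfl, rfl, n', t₁, rfl, ht, by simp [lowTail, ht]⟩
    · exact .inl ⟨by simpa [CL.lab_tag] using ht, by simp, fun p => .inl rfl,
        by simp [lowTail, ht]⟩
  case store μ σ n tpc p t₁ m t₂ k t₃ hp =>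
    simp only [ruleYields_code, rulesAbs, LExpr.eval, BExpr.Holds] at hr
    obtain ⟨hf, rfl, rfl⟩ := hr
    refine .inl ⟨by simpa [CL.lab_tag] using hpc, by simp, fun q => ?_, by simp [lowTail]⟩
    by_cases hq : q = p
    · subst hq
      -- The store check gives `L_pc ≤ L₃`, so the old cell is unobservable. The new label lies
      -- above `L_pc` too.
      refine .inr ⟨_, _, hp, Function.update_self .., ?_, ?_⟩
      · exact fun h => hpc ((le_sup_right.trans hf).trans h)
      · simp only [CL.lab_tag]
        exact fun h => hpc (le_sup_right.trans h)
    · exact .inl (by simp [Mem.write, hq])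
  -- The next pc, an emitted event and a frame pushed by `Call` all get labels above `L_pc`. A
  -- pushed atom may have a low label, but `lowTail` skips it.
  all_goals
    simp only [ruleYields_code, rulesAbs, LExpr.eval, BExpr.Holds] at hr
    obtain ⟨-, rfl, rfl⟩ := hr
    simp only at hpc
    simp [lowTail, CL.lab_tag, hpc]

/-! ### Steps from an observable program counter. -/

theorem eltIndist_data_data {a b : CAtom} :
    EltIndist CL o (.data a) (.data b) ↔ CAtomIndist CL o a b :=
  ⟨fun h => by cases h; assumption, .data⟩

theorem eltIndist_frame_frame {a b : CAtom} {π : Priv} :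
    EltIndist CL o (.frame a π) (.frame b π) ↔ CAtomIndist CL o a b :=
  ⟨fun h => by cases h; assumption, .frame⟩

theorem MemIndist.write {μ₁ μ₂ : Mem} (h : MemIndist CL o μ₁ μ₂) (p : ℤ) {a b : CAtom}
    (hab : CAtomIndist CL o a b) : MemIndist CL o (μ₁.write p a) (μ₂.write p b) := by
  intro q
  by_cases hq : q = p
  · subst hq
    simpa [Mem.write] using hab
  · simpa [Mem.write, hq] using h q

/-- Overwriting an unobservable cell by an unobservable atom. -/
theorem MemIndist.write_high {μ₁ μ₂ : Mem} (h : MemIndist CL o μ₁ μ₂) {p : ℤ} {a b : CAtom}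
    (hp : μ₁ p = some a) (ha : ¬ CL.Lab a.tag ≤ o) (hb : ¬ CL.Lab b.tag ≤ o) :
    MemIndist CL o (μ₁.write p b) μ₂ := by
  refine h.of_high_writes fun q => ?_
  by_cases hq : q = p
  · subst hq
    exact .inr ⟨a, b, hp, Function.update_self .., ha, hb⟩
  · exact .inl (by simp [Mem.write, hq])

/-- Common conclusion of all lockstep cases: the whole stacks are still related, and the new pc may
be observable or not. In the latter case `forall₂_lowTail` weakens the stack relation. -/
theorem UState.Indist.of_stack {μ₁ μ₂ : Mem} {σ₁ σ₂ : Stack} {pc₁ pc₂ : CAtom}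
    (hm : MemIndist CL o μ₁ μ₂) (hs : List.Forall₂ (EltIndist CL o) σ₁ σ₂)
    (hpc : CAtomIndist CL o pc₁ pc₂) : UState.Indist CL o ⟨μ₁, σ₁, pc₁⟩ ⟨μ₂, σ₂, pc₂⟩ := by
  refine ⟨hm, ?_⟩
  rcases hpc with rfl | ⟨h₁, h₂⟩
  · by_cases h : CL.Lab pc₁.tag ≤ o
    · exact .inl ⟨rfl, h, hs⟩
    · exact .inr ⟨h, h, forall₂_lowTail hs⟩
  · exact .inr ⟨h₁, h₂, forall₂_lowTail hs⟩

theorem filterTrace_toList_of_unobservable {α : Option CAtom}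
    (h : ∀ e ∈ α, ¬ CL.Lab e.tag ≤ o) :
    (concreteObservation CL).filterTrace o α.toList = [] := by
  cases α with
  | none => rfl
  | some e =>
    have := h e rfl
    simp [Observation.filterTrace, concreteObservation, this]

theorem filterTrace_singleton_congr {a b : CAtom} (h : CAtomIndist CL o a b) :
    (concreteObservation CL).filterTrace o [a] = (concreteObservation CL).filterTrace o [b] := by
  rcases h with rfl | ⟨h₁, h₂⟩
  · rfl
  · simp [Observation.filterTrace, concreteObservation, h₁, h₂]

/-- An atom computed from two indistinguishable pairs of atoms, labelled by their join. -/
theorem CAtomIndist.map₂ {m₁ t₁ m₁' t₁' m₂ t₂ m₂' t₂' : ℤ}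
    (h : CAtomIndist CL o ⟨m₁, t₁⟩ ⟨m₁', t₁'⟩) (h' : CAtomIndist CL o ⟨m₂, t₂⟩ ⟨m₂', t₂'⟩)
    (f : ℤ → ℤ → ℤ) :
    CAtomIndist CL o ⟨f m₁ m₂, CL.Tag (CL.Lab t₁ ⊔ CL.Lab t₂)⟩
      ⟨f m₁' m₂', CL.Tag (CL.Lab t₁' ⊔ CL.Lab t₂')⟩ := by
  rcases h with h | ⟨h₁, h₂⟩
  · rcases h' with h' | ⟨h₁, h₂⟩
    · simp only [Atom.mk.injEq] at h h'
      obtain ⟨⟨rfl, rfl⟩, rfl, rfl⟩ := And.intro h h'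
      exact .inl rfl
    · exact .inr (by simp_all [CL.lab_tag])
  · exact .inr (by simp_all [CL.lab_tag])

/-- An atom computed from indistinguishable atoms, with its label raised. -/
theorem CAtomIndist.map {m t m' t' : ℤ} (h : CAtomIndist CL o ⟨m, t⟩ ⟨m', t'⟩) (f : ℤ → ℤ)
    (l : L) :
    CAtomIndist CL o ⟨f m, CL.Tag (CL.Lab t ⊔ l)⟩ ⟨f m', CL.Tag (CL.Lab t' ⊔ l)⟩ := by
  rcases h with h | ⟨h₁, h₂⟩
  · simp only [Atom.mk.injEq] at h
    obtain ⟨rfl, rfl⟩ := h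
    exact .inl rfl
  · exact .inr (by simp_all [CL.lab_tag])

/-- Steps from indistinguishable states with an observable program counter agree. -/
theorem UserStep.of_low {TD : ℤ} {ι : InstrMem} {u₁ u₂ u₁' u₂' : UState} {α₁ α₂ : Option CAtom}
    (h₁ : UserStep CL TD ι u₁ α₁ u₁') (h₂ : UserStep CL TD ι u₂ α₂ u₂')
    (hm : MemIndist CL o u₁.mem u₂.mem) (hpc : u₁.pc = u₂.pc)
    (hs : List.Forall₂ (EltIndist CL o) u₁.stack u₂.stack) :
    u₁'.Indist CL o u₂' ∧ (concreteObservation CL).filterTrace o α₁.toList =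
      (concreteObservation CL).filterTrace o α₂.toList := by
  obtain ⟨c, i₁, trpc₁, tr₁, hc₁, hr₁, he₁⟩ := h₁
  obtain ⟨c', i₂, trpc₂, tr₂, hc₂, hr₂, he₂⟩ := h₂
  obtain ⟨μ₁, σ₁, n, t⟩ := u₁
  obtain ⟨μ₂, σ₂, n', t'⟩ := u₂
  simp only [Atom.mk.injEq] at hpc hm hs hc₁ hc₂
  obtain ⟨rfl, rfl⟩ := hpc
  -- Equal pcs fetch the same instruction, so only the diagonal cases survive the double case
  -- analysis below.
  obtain rfl : c = c' := Option.some.inj (hc₁.symm.trans hc₂)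
  cases he₁ <;> cases he₂ <;>
    simp only [ruleYields_code, rulesAbs, LExpr.eval, BExpr.Holds, List.forall₂_cons,
      eltIndist_data_data, eltIndist_frame_frame] at hr₁ hr₂ hs <;>
    obtain ⟨hf₁, rfl, rfl⟩ := hr₁ <;> obtain ⟨hf₂, rfl, rfl⟩ := hr₂
  case add.add =>
    exact ⟨.of_stack hm (.cons (.data (hs.1.map₂ hs.2.1 _)) hs.2.2) (.inl rfl), rfl⟩
  case sub.sub =>
    exact ⟨.of_stack hm (.cons (.data (hs.1.map₂ hs.2.1 _)) hs.2.2) (.inl rfl), rfl⟩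
  case output.output =>
    exact ⟨.of_stack hm hs.2 (.inl rfl), filterTrace_singleton_congr (hs.1.map id _)⟩
  case push.push =>
    exact ⟨.of_stack hm (.cons (.data (.inl rfl)) hs) (.inl rfl), rfl⟩
  case load.load p₁ t₁ m₁ t₁' hp₁ _ p₂ t₂ m₂ t₂' hp₂ =>
    refine ⟨.of_stack hm (.cons (.data ?_) hs.2) (.inl rfl), rfl⟩
    -- Equal pointers read related cells. Unobservable pointers may read different cells, but their
    -- label enters the label of the result.
    rcases hs.1 with h | ⟨h₁, h₂⟩
    · simp only [Atom.mk.injEq] at h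
      obtain ⟨rfl, rfl⟩ := h
      have hp := hm p₁
      rw [hp₁, hp₂, Option.rel_some_some] at hp
      exact hs.1.map₂ hp fun _ m => m
    · exact .inr (by simp_all [CL.lab_tag])
  case store.store p₁ t₁ m₁ t₂ k₁ t₃ hp₁ _ p₁' t₁' m₁' t₂' k₁' t₃' hp₂ =>
    refine ⟨.of_stack ?_ hs.2.2 (.inl rfl), rfl⟩
    rcases hs.1 with h | ⟨h₁, h₂⟩
    · simp only [Atom.mk.injEq] at h
      obtain ⟨rfl, rfl⟩ := h
      refine hm.write _ ?_
      simpa only [id_eq, sup_comm, sup_left_comm, sup_assoc] using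
        hs.2.1.map id (CL.Lab t₁ ⊔ CL.Lab t)
    -- With unobservable pointers the runs may write at different addresses. The check `L₁ ⊔ L_pc ≤
    -- L₃` makes each overwritten cell unobservable beforehand, so each write is absorbed
    -- separately.
    · refine (MemIndist.write_high (MemIndist.write_high hm hp₁ ?_ ?_).symm hp₂ ?_ ?_).symm
      · exact fun h => h₁ ((le_sup_left.trans hf₁).trans h)
      · simp_all [CL.lab_tag]
      · exact fun h => h₂ ((le_sup_left.trans hf₂).trans h)
      · simp_all [CL.lab_tag]
  case jump.jump =>
    exact ⟨.of_stack hm hs.2 (hs.1.map id _), rfl⟩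
  case bnz.bnz =>
    exact ⟨.of_stack hm hs.2 (hs.1.map (fun m => n + if m = 0 then 1 else _) _), rfl⟩
  case call.call =>
    -- The two return frames coincide: both hold the common `n + 1` with the label of the common pc.
    -- Only the jump target can differ.
    exact ⟨.of_stack hm (.cons (.data hs.2.1) (.cons (.frame (.inl rfl)) hs.2.2))
      (hs.1.map id _), rfl⟩
  case ret.ret =>
    exact ⟨.of_stack hm hs.2 (by simpa using hs.1.map id ⊥), rfl⟩

/-- Noninterference for the user-level machine. -/
theorem userMachine_traceIndist {TD : ℤ} {ι : InstrMem} {u₁ u₂ : UState} {t₁ t₂ : List CAtom}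
    (h : u₁.Indist CL o u₂) (h₁ : (userMachine CL TD ι).Produces u₁ t₁)
    (h₂ : (userMachine CL TD ι).Produces u₂ t₂) :
    TraceIndist ((concreteObservation CL).filterTrace o t₁)
      ((concreteObservation CL).filterTrace o t₂) := by
  obtain ⟨v₁, h₁⟩ := h₁
  obtain ⟨v₂, h₂⟩ := h₂
  revert u₂ t₂ v₂
  -- Outer induction on the first run, with the second state and its run left arbitrary.
  refine h₁.uniform_induction (motive := fun u₁ t₁ => ∀ {u₂ t₂}, u₁.Indist CL o u₂ → ∀ v₂,
    (userMachine CL TD ι).Steps u₂ t₂ v₂ →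
      TraceIndist ((concreteObservation CL).filterTrace o t₁)
        ((concreteObservation CL).filterTrace o t₂)) ?_ ?_
  · intros
    exact .nil_left _
  intro u₁ α₁ u₁' t₁ _ hu₁ _ ih₁ u₂ t₂ h v₂ h₂
  -- Inner induction on the second run. It advances the second side while the first waits to return
  -- to an observable frame.
  refine h₂.uniform_induction (motive := fun u₂ t₂ => u₁.Indist CL o u₂ →
      TraceIndist ((concreteObservation CL).filterTrace o (α₁.toList ++ t₁))
        ((concreteObservation CL).filterTrace o t₂)) ?_ ?_ h
  · intros
    exact .nil_right _
  intro u₂ α₂ u₂' t₂ v₂' hu₂ hv₂ ih₂ h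
  simp only [Observation.filterTrace_append] at ih₂ ⊢
  obtain ⟨hm, ⟨hpc, hl, hs⟩ | ⟨hl₁, hl₂, hs⟩⟩ := h
  · obtain ⟨h', hα⟩ := UserStep.of_low hu₁ hu₂ hm hpc hs
    rw [hα]
    exact (ih₁ h' _ hv₂).append _
  rcases UserStep.of_high hu₁ hl₁ with ⟨hl₁', hα₁, hm₁, hs₁⟩ | ⟨rfl, hm₁, n₁, k₁, hpc₁, hk₁, hs₁⟩
  · rw [filterTrace_toList_of_unobservable hα₁, List.nil_append,
      ← Observation.filterTrace_append]
    -- The first run's step is invisible: the outer hypothesis is applied to the whole second run,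
    -- whose first step is put back.
    refine ih₁ ⟨hm.of_high_writes hm₁, .inr ⟨hl₁', hl₂, hs₁ ▸ hs⟩⟩ v₂' ?_
    cases α₂ with
    | none => exact .silent hu₂ hv₂
    | some e => exact .event hu₂ hv₂
  rcases UserStep.of_high hu₂ hl₂ with ⟨hl₂', hα₂, hm₂, hs₂⟩ | ⟨rfl, hm₂, n₂, k₂, hpc₂, hk₂, hs₂⟩
  · rw [filterTrace_toList_of_unobservable hα₂, List.nil_append]
    exact ih₂ ⟨(hm.symm.of_high_writes hm₂).symm, .inr ⟨hl₁, hl₂', hs₂ ▸ hs⟩⟩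
  -- Both sides return. The frames at the heads of the low tails are related and observable, hence
  -- equal, so the runs meet again at one pc.
  · refine ih₁ ⟨by rwa [hm₁, hm₂], .inl ?_⟩ v₂' hv₂
    rw [hs₁, hs₂, List.forall₂_cons, eltIndist_frame_frame] at hs
    rcases hs.1 with h | h
    · simp only [Atom.mk.injEq] at h
      exact ⟨by rw [hpc₁, hpc₂, h.1, h.2], by simpa [hpc₁, CL.lab_tag] using hk₁, hs.2⟩
    · exact absurd hk₁ h.1

end UserLevel

/-! ## Hoare rules for kernel code -/

theorem CodeAt.left {φ : InstrMem} {n : ℕ} {c₁ c₂ : Code} (h : CodeAt φ n (c₁ ++ c₂)) :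
    CodeAt φ n c₁ := fun i hi => by
  rw [h i (by simp; omega), List.getElem_append_left hi]

theorem CodeAt.right {φ : InstrMem} {n : ℕ} {c₁ c₂ : Code} (h : CodeAt φ n (c₁ ++ c₂)) :
    CodeAt φ (n + c₁.length) c₂ := fun i hi => by
  rw [add_assoc, h (c₁.length + i) (by simp; omega)]
  simp

theorem CodeAt.fetch_head {φ : InstrMem} {n : ℕ} {x : Instr} {c : Code}
    (h : CodeAt φ n (x :: c)) : fetch φ n = some x := h 0 (by simp)

theorem CodeAt.tail {φ : InstrMem} {n : ℕ} {x : Instr} {c : Code} (h : CodeAt φ n (x :: c)) :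
    CodeAt φ (n + 1) c := CodeAt.right (c₁ := [x]) h

theorem codeAt_loadCode (c : Code) : CodeAt (loadCode c) 0 c := fun i hi => by
  simp [loadCode, hi]

open StackElt

section HoareRules

variable {TD : ℤ}

theorem Triple.consequence {P P' Q Q' : Mem → Stack → Prop} {c : Code} (h : Triple TD P c Q)
    (hP : ∀ κ σ, P' κ σ → P κ σ) (hQ : ∀ κ σ, Q κ σ → Q' κ σ) : Triple TD P' c Q' := by
  intro ι φ n κ μ σ hc hσ
  obtain ⟨κ', σ', hq, hs⟩ := h ι φ n κ μ σ hc (hP κ σ hσ)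
  exact ⟨κ', σ', hQ _ _ hq, hs⟩

theorem Triple.append {P Q R : Mem → Stack → Prop} {c₁ c₂ : Code} (h₁ : Triple TD P c₁ Q)
    (h₂ : Triple TD Q c₂ R) : Triple TD P (c₁ ++ c₂) R := by
  intro ι φ n κ μ σ hc hσ
  obtain ⟨κ', σ', hq, hs⟩ := h₁ ι φ n κ μ σ hc.left hσ
  obtain ⟨κ'', σ'', hr, hs'⟩ := h₂ ι φ _ κ' μ σ' hc.right hq
  refine ⟨κ'', σ'', hr, hs.trans ?_⟩
  rwa [List.length_append, ← add_assoc]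

theorem Triple.nil {P Q : Mem → Stack → Prop} (h : ∀ κ σ, P κ σ → Q κ σ) : Triple TD P [] Q :=
  fun _ _ _ κ _ σ _ hσ => ⟨κ, σ, h κ σ hσ, .refl⟩

/-- Covers instructions that fall through to the next address; proper jumps are treated by explicit
steps. -/
theorem triple_singleton {P Q : Mem → Stack → Prop} {x : Instr}
    (h : ∀ (ι φ : InstrMem) (n : ℤ) (κ μ : Mem) (σ : Stack), fetch φ n = some x → P κ σ →
      ∃ κ' σ', Q κ' σ' ∧ CStep TD ι φ ⟨.kernel, κ, μ, σ, ⟨n, TD⟩⟩ none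
        ⟨.kernel, κ', μ, σ', ⟨n + 1, TD⟩⟩) : Triple TD P [x] Q := by
  intro ι φ n κ μ σ hc hσ
  obtain ⟨κ', σ', hq, hs⟩ := h ι φ n κ μ σ hc.fetch_head hσ
  exact ⟨κ', σ', hq, .single ⟨rfl, by simpa using hs⟩⟩

theorem triple_push (Q : Mem → Stack → Prop) (m : ℤ) :
    Triple TD (fun κ σ => Q κ (data ⟨m, TD⟩ :: σ)) [.push m] Q :=
  triple_singleton fun _ _ _ _ _ _ hf h => ⟨_, _, h, .pushK hf⟩

theorem triple_sub (Q : Mem → Stack → Prop) :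
    Triple TD (fun κ σ => ∃ a b σ', σ = data a :: data b :: σ' ∧
      Q κ (data ⟨a.val - b.val, TD⟩ :: σ')) [.sub] Q :=
  triple_singleton fun _ _ _ _ _ _ hf ⟨_, _, _, hσ, h⟩ => ⟨_, _, h, hσ ▸ .subK hf⟩

theorem triple_genLoadFrom (Q : Mem → Stack → Prop) (p : ℤ) :
    Triple TD (fun κ σ => ∃ a, κ p = some a ∧ Q κ (data a :: σ)) (genLoadFrom p) Q := by
  refine Triple.append (c₁ := [.push p]) (c₂ := [.load])
    (Q := fun κ σ => ∃ a t σ', κ p = some a ∧ σ = data ⟨p, t⟩ :: σ' ∧ Q κ (data a :: σ')) ?_ ?_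
  · exact (triple_push _ p).consequence (fun κ σ ⟨a, ha, h⟩ => ⟨a, TD, σ, ha, rfl, h⟩)
      fun _ _ h => h
  · exact triple_singleton fun _ _ _ _ _ _ hf ⟨_, _, _, ha, hσ, h⟩ =>
      ⟨_, _, h, hσ ▸ .loadK hf ha⟩

theorem triple_genStoreAt (Q : Mem → Stack → Prop) (p : ℤ) :
    Triple TD (fun κ σ => ∃ a σ', σ = data a :: σ' ∧ Q (κ.write p a) σ') (genStoreAt p) Q := by
  refine Triple.append (c₁ := [.push p]) (c₂ := [.store])
    (Q := fun κ σ => ∃ a t σ', σ = data ⟨p, t⟩ :: data a :: σ' ∧ Q (κ.write p a) σ') ?_ ?_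
  · exact (triple_push _ p).consequence (fun κ σ ⟨a, σ', hσ, h⟩ => ⟨a, TD, σ', by rw [hσ], h⟩)
      fun _ _ h => h
  · exact triple_singleton fun _ _ _ _ _ _ hf ⟨_, _, _, hσ, h⟩ => ⟨_, _, h, hσ ▸ .storeK hf⟩

/-- A branch with offset `1` reaches the next instruction whatever the operand is. -/
theorem triple_genPop (Q : Mem → Stack → Prop) :
    Triple TD (fun κ σ => ∃ a σ', σ = data a :: σ' ∧ Q κ σ') genPop Q :=
  triple_singleton fun ι φ n κ μ _ hf ⟨a, σ', hσ, h⟩ => ⟨κ, σ', h, by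
    subst hσ
    simpa using CStep.bnzK (TD := TD) (ι := ι) (κ := κ) (μ := μ) (σ := σ') (tpc := TD)
      (m := a.val) (t₁ := a.tag) hf⟩

/-- A conditional jump in kernel mode. -/
theorem kernelSteps_bnz {ι φ : InstrMem} {n : ℕ} {k : ℤ} {κ μ : Mem} {σ : Stack} {b t : ℤ}
    (hf : fetch φ n = some (.bnz k)) :
    KernelSteps TD ι φ ⟨.kernel, κ, μ, data ⟨b, t⟩ :: σ, ⟨n, TD⟩⟩
      ⟨.kernel, κ, μ, σ, ⟨n + (if b = 0 then 1 else k), TD⟩⟩ :=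
  .single ⟨rfl, .bnzK hf⟩

theorem genIf_eq (t f : Code) :
    genIf t f = .bnz (f.length + 3) :: (f ++ .push 1 :: .bnz (t.length + 1) :: t) := by
  simp [genIf, genSkipIf, genSkip, genTrue, add_assoc]

theorem length_genIf (t f : Code) : (genIf t f).length = f.length + t.length + 3 := by
  simp [genIf_eq]
  ring

theorem Triple.genIf {P₁ P₂ Q : Mem → Stack → Prop} {t f : Code} (ht : Triple TD P₁ t Q)
    (hf : Triple TD P₂ f Q) :
    Triple TD (fun κ σ => ∃ a σ', σ = data a :: σ' ∧ (a.val ≠ 0 → P₁ κ σ') ∧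
      (a.val = 0 → P₂ κ σ')) (genIf t f) Q := by
  rintro ι φ n κ μ _ hc ⟨⟨b, s⟩, σ, rfl, h₁, h₂⟩
  rw [length_genIf]
  rw [genIf_eq] at hc
  have hb := kernelSteps_bnz (TD := TD) (ι := ι) (κ := κ) (μ := μ) (σ := σ) (b := b) (t := s)
    hc.fetch_head
  by_cases hb0 : b = 0
  · obtain ⟨κ', σ', hq, hs⟩ := hf ι φ (n + 1) κ μ σ hc.tail.left (h₂ hb0)
    have hcs := hc.tail.right
    rw [if_pos hb0] at hb
    -- After `f`, the pushed `1` makes this branch unconditional; its offset `t.length + 1` leads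
    -- just past `t`.
    have hj := kernelSteps_bnz (TD := TD) (ι := ι) (κ := κ') (μ := μ) (σ := σ') (b := 1)
      (t := TD) hcs.tail.fetch_head
    refine ⟨κ', σ', hq, hb.trans (hs.trans (.head ⟨rfl, .pushK hcs.fetch_head⟩ ?_))⟩
    change KernelSteps TD ι φ _ _
    convert hj using 3
    · simp
    · simp
      ring
  -- The code `t` is preceded by the test, `f`, and the two instructions of the skip, hence the
  -- offset `f.length + 3`.
  · have hct : CodeAt φ (n + (f.length + 3)) t := by
      have := hc.tail.right.tail.tail
      convert this using 1
      ring
    obtain ⟨κ', σ', hq, hs⟩ := ht ι φ _ κ μ σ hct (h₁ hb0)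
    rw [if_neg hb0] at hb
    have e : n + (f.length + t.length + 3) = n + (f.length + 3) + t.length := by ring
    refine ⟨κ', σ', hq, hb.trans ?_⟩
    rw [e]
    change KernelSteps TD ι φ _ _
    simpa using hs

theorem triple_genNot (Q : Mem → Stack → Prop) :
    Triple TD (fun κ σ => ∃ a σ', σ = data a :: σ' ∧
      Q κ (data ⟨if a.val = 0 then 1 else 0, TD⟩ :: σ')) genNot Q := by
  refine (Triple.genIf (triple_push Q 0) (triple_push Q 1)).consequence ?_ fun _ _ h => h
  rintro κ σ ⟨a, σ', hσ, h⟩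
  exact ⟨a, σ', hσ, fun ha => by simpa [ha] using h, fun ha => by simpa [ha] using h⟩

/-- The second operand must carry the tag `TD`, because one branch leaves it in place as the result;
the first is always consumed. -/
theorem triple_genAnd (Q : Mem → Stack → Prop) :
    Triple TD (fun κ σ => ∃ a b σ', σ = data a :: data ⟨b, TD⟩ :: σ' ∧
      Q κ (data ⟨if a.val = 0 then 0 else b, TD⟩ :: σ')) genAnd Q := by
  refine (Triple.genIf (Triple.nil fun _ _ h => h)
    ((triple_genPop _).append (triple_push Q 0))).consequence ?_ fun _ _ h => h
  rintro κ σ ⟨a, b, σ', hσ, h⟩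
  exact ⟨a, _, hσ, fun ha => by simpa [ha] using h,
    fun ha => ⟨_, _, rfl, by simpa [ha] using h⟩⟩

theorem triple_genOr (Q : Mem → Stack → Prop) :
    Triple TD (fun κ σ => ∃ a b σ', σ = data a :: data ⟨b, TD⟩ :: σ' ∧
      Q κ (data ⟨if a.val = 0 then b else 1, TD⟩ :: σ')) genOr Q := by
  refine (Triple.genIf ((triple_genPop _).append (triple_push Q 1))
    (Triple.nil fun _ _ h => h)).consequence ?_ fun _ _ h => h
  rintro κ σ ⟨a, b, σ', hσ, h⟩
  exact ⟨a, _, hσ, fun ha => ⟨_, _, rfl, by simpa [ha] using h⟩,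
    fun ha => by simpa [ha] using h⟩

theorem triple_genMatchOp (Q : Mem → Stack → Prop) (op : Opcode) :
    Triple TD (fun κ σ => ∃ a, κ addrOp = some a ∧
      Q κ (data ⟨if a.val = op.code then 1 else 0, TD⟩ :: σ)) (genMatchOp op) Q := by
  refine (((triple_push _ op.code).append (triple_genLoadFrom _ addrOp)).append
    ((triple_sub _).append (triple_genNot Q))).consequence ?_ fun _ _ h => h
  rintro κ σ ⟨a, ha, h⟩
  exact ⟨a, ha, _, _, _, rfl, _, _, rfl, by simpa [sub_eq_zero] using h⟩

/-- Dispatch on the opcode in the cache. -/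
theorem triple_genIndexedCases {P Q : Mem → Stack → Prop} {op : Opcode} {d : Code}
    {body : Opcode → Code} (hP : ∀ κ σ, P κ σ → ∃ t, κ addrOp = some ⟨op.code, t⟩)
    (hbody : Triple TD P (body op) Q) {ops : List Opcode} (hop : op ∈ ops) :
    Triple TD P (genIndexedCases d genMatchOp body ops) Q := by
  induction ops with
  | nil => simp at hop
  | cons op' ops ih =>
    by_cases h : op = op'
    · subst h
      -- The branch not taken gets the precondition `False`. Nothing is then required of code for
      -- other opcodes, whose rules might read tags that encode no label.
      refine ((triple_genMatchOp _ op).append (hbody.genIf (P₂ := fun _ _ => False)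
        fun _ _ _ _ _ _ _ h => h.elim)).consequence ?_ fun _ _ h => h
      intro κ σ hσ
      obtain ⟨t, ht⟩ := hP κ σ hσ
      exact ⟨_, ht, _, _, rfl, fun _ => hσ, by simp⟩
    · refine ((triple_genMatchOp _ op').append (Triple.genIf (P₁ := fun _ _ => False)
        (fun _ _ _ _ _ _ _ h => h.elim) (ih (by simpa [h] using hop)))).consequence ?_
        fun _ _ h => h
      intro κ σ hσ
      obtain ⟨t, ht⟩ := hP κ σ hσ
      have : op.code ≠ op'.code := fun h' => h (Opcode.code_injective h')
      exact ⟨_, ht, _, _, rfl, by simp [this], fun _ => hσ⟩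

end HoareRules

/-! ## Correctness of the fault handler -/

section Handler

variable {L : Type*} [SemilatticeSup L] [OrderBot L] (CL : ConcreteLattice L) {TD : ℤ}

/-- The tag encodes a label. -/
def ConcreteLattice.Encodes (t : ℤ) : Prop := CL.Tag (CL.Lab t) = t

/-- All tags of the cache input that occur in the expression encode labels. -/
def LExpr.Encoded (i : CacheIn) : LExpr → Prop
  | .bot => True
  | .labPC => CL.Encodes i.tpc
  | .lab1 => CL.Encodes i.t1
  | .lab2 => CL.Encodes i.t2
  | .lab3 => CL.Encodes i.t3
  | .join e₁ e₂ => e₁.Encoded i ∧ e₂.Encoded i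

/-- All tags of the cache input that occur in the expression encode labels. -/
def BExpr.Encoded (i : CacheIn) : BExpr → Prop
  | .tru => True
  | .flows e₁ e₂ => e₁.Encoded CL i ∧ e₂.Encoded CL i
  | .and b₁ b₂ => b₁.Encoded i ∧ b₂.Encoded i
  | .or b₁ b₂ => b₁.Encoded i ∧ b₂.Encoded i

/-- All tags of the cache input that occur in the rule encode labels. -/
def Rule.Encoded (i : CacheIn) (r : Rule) : Prop :=
  r.allow.Encoded CL i ∧ r.erpc.Encoded CL i ∧ r.er.Encoded CL i

/-- The cache in `κ` has input part `i`, with default tags. -/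
def HasInput (TD : ℤ) (i : CacheIn) (κ : Mem) : Prop :=
  κ addrOp = some ⟨i.op, TD⟩ ∧ κ addrTagPC = some ⟨i.tpc, TD⟩ ∧ κ addrTag1 = some ⟨i.t1, TD⟩ ∧
    κ addrTag2 = some ⟨i.t2, TD⟩ ∧ κ addrTag3 = some ⟨i.t3, TD⟩

theorem hasInput_setCache (κ : Mem) (i : CacheIn) : HasInput TD i (setCache TD κ i) := by
  simp [HasInput, setCache, Mem.write, addrOp, addrTagPC, addrTag1,
    addrTag2, addrTag3, addrTagRPC, addrTagR]

variable {CL} {i : CacheIn}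

/-- The code leaves `κ` unchanged, which an arbitrary `Q` expresses by being evaluated at the same
`κ`. Hence `HasInput` is available again for the next subexpression. Compiling `e₂` before `e₁`
leaves `e₁` on top, as `genJoin` expects. -/
theorem triple_genELab (hCL : CL.Correct TD) {e : LExpr} (he : e.Encoded CL i)
    (Q : Mem → Stack → Prop) :
    Triple TD (fun κ σ => HasInput TD i κ ∧ Q κ (data ⟨CL.Tag (e.eval CL i), TD⟩ :: σ))
      (genELab CL e) Q := by
  induction e generalizing Q with
  | bot => exact (hCL.bot Q).consequence (fun _ _ h => h.2) fun _ _ h => h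
  | labPC =>
    -- The term `he.trans rfl` exposes the equation `CL.Tag (CL.Lab i.tpc) = i.tpc`: the raw tag in
    -- the cache is the code of the label that the expression denotes.
    exact (triple_genLoadFrom Q _).consequence
      (fun _ _ h => ⟨_, h.1.2.1, by simpa only [LExpr.eval, he.trans rfl] using h.2⟩)
      fun _ _ h => h
  | lab1 =>
    exact (triple_genLoadFrom Q _).consequence
      (fun _ _ h => ⟨_, h.1.2.2.1, by simpa only [LExpr.eval, he.trans rfl] using h.2⟩)
      fun _ _ h => h
  | lab2 =>
    exact (triple_genLoadFrom Q _).consequence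
      (fun _ _ h => ⟨_, h.1.2.2.2.1, by simpa only [LExpr.eval, he.trans rfl] using h.2⟩)
      fun _ _ h => h
  | lab3 =>
    exact (triple_genLoadFrom Q _).consequence
      (fun _ _ h => ⟨_, h.1.2.2.2.2, by simpa only [LExpr.eval, he.trans rfl] using h.2⟩)
      fun _ _ h => h
  | join e₁ e₂ ih₁ ih₂ =>
    exact (((ih₂ he.2 _).append (ih₁ he.1 _)).append (hCL.join Q)).consequence
      (fun _ _ h => ⟨h.1, h.1, _, _, _, rfl, h.2⟩) fun _ _ h => h

/-- The precondition ranges over all `v` because `genFlows` fixes its result only up to being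
non-zero. -/
theorem triple_genBool (hCL : CL.Correct TD) {b : BExpr} (hb : b.Encoded CL i)
    (Q : Mem → Stack → Prop) :
    Triple TD (fun κ σ => HasInput TD i κ ∧
        ∀ v : ℤ, (v ≠ 0 ↔ b.Holds CL i) → Q κ (data ⟨v, TD⟩ :: σ))
      (genBool CL b) Q := by
  induction b generalizing Q with
  | tru =>
    exact (triple_push Q 1).consequence (fun _ _ h => h.2 1 (by simp [BExpr.Holds]))
      fun _ _ h => h
  | flows e₁ e₂ =>
    exact (((triple_genELab hCL hb.2 _).append (triple_genELab hCL hb.1 _)).append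
      (hCL.flows Q)).consequence
      (fun _ _ h => ⟨h.1, h.1, _, _, _, rfl, h.2⟩) fun _ _ h => h
  | and b₁ b₂ ih₁ ih₂ =>
    refine (((ih₂ hb.2 _).append (ih₁ hb.1 _)).append (triple_genAnd Q)).consequence
      (fun κ σ h => ⟨h.1, fun v₂ h₂ => ⟨h.1, fun v₁ h₁ => ⟨_, _, _, rfl, h.2 _ ?_⟩⟩⟩) fun _ _ h => h
    by_cases hv : v₁ = 0 <;> simp_all [BExpr.Holds]
  | or b₁ b₂ ih₁ ih₂ =>
    refine (((ih₂ hb.2 _).append (ih₁ hb.1 _)).append (triple_genOr Q)).consequence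
      (fun κ σ h => ⟨h.1, fun v₂ h₂ => ⟨h.1, fun v₁ h₁ => ⟨_, _, _, rfl, h.2 _ ?_⟩⟩⟩) fun _ _ h => h
    by_cases hv : v₁ = 0 <;> simp_all [BExpr.Holds]

theorem triple_genApplyRule (hCL : CL.Correct TD) {r : Rule} (hr : r.Encoded CL i)
    (Q : Mem → Stack → Prop) :
    Triple TD (fun κ σ => HasInput TD i κ ∧
        (r.allow.Holds CL i → Q κ (data ⟨1, TD⟩ :: data ⟨CL.Tag (r.er.eval CL i), TD⟩ ::
          data ⟨CL.Tag (r.erpc.eval CL i), TD⟩ :: σ)) ∧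
        (¬ r.allow.Holds CL i → Q κ (data ⟨0, TD⟩ :: σ)))
      (genApplyRule CL r) Q := by
  refine ((triple_genBool hCL hr.1 _).append (Triple.genIf
    (((triple_genELab hCL hr.2.1 _).append (triple_genELab hCL hr.2.2 _)).append
      (triple_push Q 1)) (triple_push Q 0))).consequence ?_ fun _ _ h => h
  rintro κ σ ⟨hi, h₁, h₂⟩
  exact ⟨hi, fun v hv => ⟨_, _, rfl, fun h => ⟨hi, hi, h₁ (hv.1 h)⟩,
    fun h => h₂ (mt hv.2 (not_not.2 h))⟩⟩

theorem mem_opcodes (op : Opcode) : op ∈ opcodes := by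
  cases op <;> simp [opcodes]

theorem triple_genComputeResults (hCL : CL.Correct TD) {R : RuleTable} {op : Opcode}
    (hop : i.op = op.code) (hr : (R op).Encoded CL i) (Q : Mem → Stack → Prop) :
    Triple TD (fun κ σ => HasInput TD i κ ∧
        ((R op).allow.Holds CL i → Q κ (data ⟨1, TD⟩ ::
          data ⟨CL.Tag ((R op).er.eval CL i), TD⟩ ::
          data ⟨CL.Tag ((R op).erpc.eval CL i), TD⟩ :: σ)) ∧
        (¬ (R op).allow.Holds CL i → Q κ (data ⟨0, TD⟩ :: σ)))
      (genComputeResults CL R) Q :=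
  triple_genIndexedCases (op := op) (fun _ _ h => ⟨TD, hop ▸ h.1.1⟩)
    (triple_genApplyRule hCL hr Q) (mem_opcodes op)

theorem triple_genStoreResults (Q : Mem → Stack → Prop) :
    Triple TD (fun κ σ => ∃ a σ', σ = data a :: σ' ∧
        (a.val ≠ 0 → ∃ b c σ'', σ' = data b :: data c :: σ'' ∧
          Q ((κ.write addrTagR b).write addrTagRPC c) (data ⟨1, TD⟩ :: σ'')) ∧
        (a.val = 0 → Q κ (data ⟨0, TD⟩ :: σ')))
      genStoreResults Q := by
  refine (Triple.genIf (((triple_genStoreAt _ addrTagR).append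
    (triple_genStoreAt _ addrTagRPC)).append (triple_push Q 1))
    (triple_push Q 0)).consequence ?_ fun _ _ h => h
  rintro κ σ ⟨a, σ', hσ, h₁, h₂⟩
  refine ⟨a, σ', hσ, fun ha => ?_, h₂⟩
  obtain ⟨b, c, σ'', rfl, h⟩ := h₁ ha
  exact ⟨b, _, rfl, c, _, rfl, h⟩

/-- A state in which the machine has halted with an invalid kernel program counter. -/
def CState.Halted (s : CState) : Prop := s.priv = .kernel ∧ s.pc.val = -1

/-- The fault handler either returns to user mode with the result of the rule in the cache, or
halts. -/
theorem faultHandler_correct (hCL : CL.Correct TD) {R : RuleTable} {op : Opcode}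
    (hop : i.op = op.code) (hr : (R op).Encoded CL i) (ι : InstrMem) {κ : Mem}
    (hκ : HasInput TD i κ) (μ : Mem) (σ : Stack) (pc : CAtom) :
    ∃ s', KernelSteps TD ι (loadCode (genFaultHandler CL R))
        ⟨.kernel, κ, μ, .frame pc .user :: σ, ⟨0, TD⟩⟩ s' ∧
      (((R op).allow.Holds CL i ∧ s' = ⟨.user,
          (κ.write addrTagR ⟨CL.Tag ((R op).er.eval CL i), TD⟩).write addrTagRPC
            ⟨CL.Tag ((R op).erpc.eval CL i), TD⟩, μ, σ, pc⟩) ∨ s'.Halted) := by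
  set φ := loadCode (genFaultHandler CL R) with hφ
  have hc : CodeAt φ 0 (genFaultHandler CL R) := codeAt_loadCode _
  -- The triples cover the handler up to its final conditional. That conditional leaves the code by
  -- `Ret` or `Jump`, which a `Triple` cannot describe, so it is executed by hand. The flag on top
  -- of the stack records whether the rule allowed the step.
  obtain ⟨κ', σ', hq, hs⟩ := (triple_genComputeResults hCL hop hr _).append
    (triple_genStoreResults (fun κ' σ' =>
      ((R op).allow.Holds CL i ∧ κ' = (κ.write addrTagR
        ⟨CL.Tag ((R op).er.eval CL i), TD⟩).write addrTagRPC
          ⟨CL.Tag ((R op).erpc.eval CL i), TD⟩ ∧ σ' = data ⟨1, TD⟩ :: frame pc .user :: σ) ∨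
      ∃ σ'', σ' = data ⟨0, TD⟩ :: σ'')) ι φ 0 κ μ (frame pc .user :: σ) hc.left
    ⟨hκ, fun h => ⟨_, _, rfl, fun _ => ⟨_, _, _, rfl, .inl ⟨h, rfl, rfl⟩⟩, by simp⟩,
      fun _ => ⟨_, _, rfl, by simp, fun _ => .inr ⟨_, rfl⟩⟩⟩
  have hc' := hc.right
  rw [genIf_eq] at hc'
  rcases hq with ⟨hh, rfl, rfl⟩ | ⟨σ'', rfl⟩
  · refine ⟨_, hs.trans ((kernelSteps_bnz hc'.fetch_head).trans (.single ⟨rfl, .retK ?_⟩)),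
      .inl ⟨hh, rfl⟩⟩
    -- `Ret` sits at offset `5`: the test, two instructions of the failure branch and two of the
    -- skip precede it.
    simpa [add_assoc] using hc'.tail.tail.tail.tail.tail.fetch_head
  · have hj := hc'.tail.tail.fetch_head
    push_cast at hj
    refine ⟨_, hs.trans ((kernelSteps_bnz hc'.fetch_head).trans
      (.head ⟨rfl, .pushK ?_⟩ (.single ⟨rfl, .jumpK hj⟩))), .inr ⟨rfl, rfl⟩⟩
    simpa using hc'.tail.fetch_head

end Handler

/-! ## The concrete machine simulates the user-level machine -/

/-- A step in user mode is an instruction with a cache hit, or a cache miss. -/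
theorem CStep.user_cases {TD : ℤ} {ι φ : InstrMem} {u : UState} {κ : Mem} {α : Option CAtom}
    {s' : CState} (h : CStep TD ι φ (u.withKernel κ) α s') :
    ∃ c i, fetch ι u.pc.val = some c ∧
      ((∃ trpc tr u', CacheHit κ i trpc tr ∧ Effect TD trpc tr c u i α u' ∧
          s' = u'.withKernel κ) ∨
        (α = none ∧ s' = faultState TD κ u.mem u.stack u.pc i ∧
          ∃ α' u', Effect TD TD TD c u i α' u')) := by
  obtain ⟨μ, σ, pc⟩ := u
  cases h with
  | add hf hh => exact ⟨_, _, hf, .inl ⟨_, _, _, hh, .add, rfl⟩⟩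
  | sub hf hh => exact ⟨_, _, hf, .inl ⟨_, _, _, hh, .sub, rfl⟩⟩
  | output hf hh => exact ⟨_, _, hf, .inl ⟨_, _, _, hh, .output, rfl⟩⟩
  | push hf hh => exact ⟨_, _, hf, .inl ⟨_, _, _, hh, .push, rfl⟩⟩
  | load hf hp hh => exact ⟨_, _, hf, .inl ⟨_, _, _, hh, .load hp, rfl⟩⟩
  | store hf hp hh => exact ⟨_, _, hf, .inl ⟨_, _, _, hh, .store hp, rfl⟩⟩
  | jump hf hh => exact ⟨_, _, hf, .inl ⟨_, _, _, hh, .jump, rfl⟩⟩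
  | bnz hf hh => exact ⟨_, _, hf, .inl ⟨_, _, _, hh, .bnz, rfl⟩⟩
  | call hf hh => exact ⟨_, _, hf, .inl ⟨_, _, _, hh, .call, rfl⟩⟩
  | ret hf hh => exact ⟨_, _, hf, .inl ⟨_, _, _, hh, .ret, rfl⟩⟩
  -- On a miss the effect only certifies that `i` is the input needed by an instruction whose
  -- operands exist; the outputs `TD`, `TD` are placeholders.
  | addMiss hf _ => exact ⟨_, _, hf, .inr ⟨rfl, rfl, _, _, .add⟩⟩
  | subMiss hf _ => exact ⟨_, _, hf, .inr ⟨rfl, rfl, _, _, .sub⟩⟩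
  | outputMiss hf _ => exact ⟨_, _, hf, .inr ⟨rfl, rfl, _, _, .output⟩⟩
  | pushMiss hf _ => exact ⟨_, _, hf, .inr ⟨rfl, rfl, _, _, .push⟩⟩
  | loadMiss hf hp _ => exact ⟨_, _, hf, .inr ⟨rfl, rfl, _, _, .load hp⟩⟩
  | storeMiss hf hp _ => exact ⟨_, _, hf, .inr ⟨rfl, rfl, _, _, .store hp⟩⟩
  | jumpMiss hf _ => exact ⟨_, _, hf, .inr ⟨rfl, rfl, _, _, .jump⟩⟩
  | bnzMiss hf _ => exact ⟨_, _, hf, .inr ⟨rfl, rfl, _, _, .bnz⟩⟩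
  | callMiss hf _ => exact ⟨_, _, hf, .inr ⟨rfl, rfl, _, _, .call⟩⟩
  | retMiss hf _ => exact ⟨_, _, hf, .inr ⟨rfl, rfl, _, _, .ret⟩⟩

/-- Kernel mode is silent. -/
theorem CStep.kernel_silent {TD : ℤ} {ι φ : InstrMem} {s s' : CState} {α : Option CAtom}
    (hs : s.priv = .kernel) (h : CStep TD ι φ s α s') : α = none := by
  cases h <;> first | rfl | cases hs

/-- Kernel mode is deterministic. -/
theorem CStep.kernel_deterministic {TD : ℤ} {ι φ : InstrMem} {s s₁ s₂ : CState}
    {α₁ α₂ : Option CAtom} (hs : s.priv = .kernel) (h₁ : CStep TD ι φ s α₁ s₁)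
    (h₂ : CStep TD ι φ s α₂ s₂) : s₁ = s₂ := by
  obtain ⟨π, κ, μ, σ, pc⟩ := s
  obtain rfl : π = .kernel := hs
  cases h₁ <;> cases h₂ <;> simp_all

/-- Every kernel step fetches an instruction, and there is none at address `-1`. -/
theorem CState.Halted.not_step {TD : ℤ} {ι φ : InstrMem} {s s' : CState} {α : Option CAtom}
    (hs : s.Halted) : ¬ CStep TD ι φ s α s' := by
  obtain ⟨π, κ, μ, σ, n, t⟩ := s
  obtain ⟨h₁, h₂⟩ := hs
  obtain rfl : π = .kernel := h₁
  obtain rfl : n = -1 := h₂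
  intro h
  cases h <;> rename_i hf <;> cases hf

section Simulation

set_option linter.unusedSectionVars false

variable {L : Type*} [SemilatticeSup L] [OrderBot L] (CL : ConcreteLattice L)

/-- The tag of a stack element. -/
def StackElt.tag : StackElt → ℤ
  | .data a => a.tag
  | .frame a _ => a.tag

/-- All tags in the user state encode labels. -/
def UState.Encoded (u : UState) : Prop :=
  (∀ p a, u.mem p = some a → CL.Encodes a.tag) ∧ (∀ x ∈ u.stack, CL.Encodes x.tag) ∧
    CL.Encodes u.pc.tag

/-- Whatever the cache holds for a legal opcode is what the rule table yields. -/
def CacheValid (κ : Mem) : Prop :=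
  ∀ i trpc tr, CacheHit κ i trpc tr → i.op ≠ illegalOpcode → RuleYields CL i trpc tr

variable {CL} {TD : ℤ}

/-! ### Invariants: tags that encode labels, and valid caches. -/

theorem ConcreteLattice.encodes_tag (l : L) : CL.Encodes (CL.Tag l) := by
  rw [ConcreteLattice.Encodes, CL.lab_tag]

/-- The default tag `TD` fills the unused inputs and need not encode a label. Each rule mentions
only inputs that really come from the pc, an operand or a memory cell. -/
theorem Effect.ruleEncoded {c : Instr} {u u' : UState} {i : CacheIn} {α : Option CAtom}
    {trpc tr : ℤ} (h : Effect TD trpc tr c u i α u') (hu : u.Encoded CL) :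
    ∃ op : Opcode, i.op = op.code ∧ (rulesAbs op).Encoded CL i := by
  have of_code {op : Opcode} {tpc t₁ t₂ t₃ : ℤ}
      (h : (rulesAbs op).Encoded CL ⟨op.code, tpc, t₁, t₂, t₃⟩) :
      ∃ op' : Opcode, (⟨op.code, tpc, t₁, t₂, t₃⟩ : CacheIn).op = op'.code ∧
        (rulesAbs op').Encoded CL ⟨op.code, tpc, t₁, t₂, t₃⟩ := ⟨op, rfl, h⟩
  obtain ⟨hm, hs, hpc⟩ := hu
  cases h
  case load hp =>
    have := hm _ _ hp
    refine of_code ?_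
    simp_all [Rule.Encoded, rulesAbs, LExpr.Encoded, BExpr.Encoded, StackElt.tag]
  case store hp =>
    have := hm _ _ hp
    refine of_code ?_
    simp_all [Rule.Encoded, rulesAbs, LExpr.Encoded, BExpr.Encoded, StackElt.tag]
  all_goals
    refine of_code ?_
    simp_all [Rule.Encoded, rulesAbs, LExpr.Encoded, BExpr.Encoded, StackElt.tag]

/-- The only tags an instruction introduces are `trpc` and `tr`; all others are inherited. -/
theorem Effect.encoded {c : Instr} {u u' : UState} {i : CacheIn} {α : Option CAtom}
    {trpc tr : ℤ} (h : Effect TD trpc tr c u i α u') (hu : u.Encoded CL)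
    (htrpc : CL.Encodes trpc) (htr : CL.Encodes tr) : u'.Encoded CL := by
  obtain ⟨hm, hs, hpc⟩ := hu
  cases h
  case store μ σ n tpc p t₁ m t₂ k t₃ hp =>
    refine ⟨fun q a hq => ?_, by simp_all, htrpc⟩
    by_cases hqp : q = p
    · subst hqp
      obtain rfl : (⟨m, tr⟩ : CAtom) = a := by simpa [Mem.write] using hq
      exact htr
    · exact hm q a (by simpa [Mem.write, hqp] using hq)
  all_goals exact ⟨hm, by simp_all [StackElt.tag], htrpc⟩

theorem RuleYields.encodes {i : CacheIn} {trpc tr : ℤ} (h : RuleYields CL i trpc tr) :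
    CL.Encodes trpc ∧ CL.Encodes tr := by
  obtain ⟨op, -, -, rfl, rfl⟩ := h
  exact ⟨CL.encodes_tag _, CL.encodes_tag _⟩

theorem Opcode.code_ne_illegalOpcode (op : Opcode) : op.code ≠ illegalOpcode := by
  cases op <;> simp [Opcode.code, illegalOpcode]

/-- The cache that the fault handler leaves behind is valid. -/
theorem cacheValid_of_hasInput {i : CacheIn} {κ : Mem} (hκ : HasInput TD i κ) {op : Opcode}
    (hop : i.op = op.code) (ha : (rulesAbs op).allow.Holds CL i) :
    CacheValid CL ((κ.write addrTagR ⟨CL.Tag ((rulesAbs op).er.eval CL i), TD⟩).write addrTagRPC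
      ⟨CL.Tag ((rulesAbs op).erpc.eval CL i), TD⟩) := by
  rintro ⟨op', tpc, t₁, t₂, t₃⟩ trpc tr ⟨⟨h₀, h₁, h₂, h₃, h₄⟩, h₅, h₆⟩ -
  obtain ⟨k₀, k₁, k₂, k₃, k₄⟩ := hκ
  obtain ⟨iop, itpc, i1, i2, i3⟩ := i
  simp only [addrOp, addrTagPC, addrTag1, addrTag2, addrTag3] at k₀ k₁ k₂ k₃ k₄
  -- The handler writes only cells 5 and 6, so the input part is still `i`, and a hit must agree
  -- with it componentwise.
  simp [payload, Mem.write, addrOp, addrTagPC, addrTag1, addrTag2,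
    addrTag3, addrTagRPC, addrTagR, k₀, k₁, k₂, k₃, k₄] at h₀ h₁ h₂ h₃ h₄ h₅ h₆
  subst h₀ h₁ h₂ h₃ h₄
  exact ⟨op, hop, ha, h₅.symm, h₆.symm⟩

/-- Vacuous: the initial opcode is illegal. -/
theorem cacheValid_initKMem : CacheValid CL (initKMem TD) := by
  intro i trpc tr h hop
  refine absurd ?_ hop
  have h₀ := h.1.1
  rw [payload, initKMem, (hasInput_setCache _ _).1] at h₀
  exact (Option.some.inj h₀).symm

/-- The concrete state `s` represents the user state `u`: kernel code leads from `s` to `u` with a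
valid cache, or halts. -/
def Represents (CL : ConcreteLattice L) (TD : ℤ) (ι φ : InstrMem) (s : CState) (u : UState) :
    Prop :=
  ∃ v, KernelSteps TD ι φ s v ∧ ((∃ κ, CacheValid CL κ ∧ v = u.withKernel κ) ∨ v.Halted)

/-- Every trace of the concrete machine is a trace of the user-level machine. -/
theorem produces_userMachine (hCL : CL.Correct TD) {p : InstrMem × CState} {u : UState}
    {t : List CAtom}
    (h : (concreteMachine TD (loadCode (genFaultHandler CL rulesAbs))).Produces p t)
    (hu : u.Encoded CL)
    (hp : Represents CL TD p.1 (loadCode (genFaultHandler CL rulesAbs)) p.2 u) :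
    (userMachine CL TD p.1).Produces u t := by
  obtain ⟨p', h⟩ := h
  revert u
  refine h.uniform_induction (motive := fun p t => ∀ {u : UState}, u.Encoded CL →
    Represents CL TD p.1 (loadCode (genFaultHandler CL rulesAbs)) p.2 u →
    (userMachine CL TD p.1).Produces u t) (fun _ u _ _ => ⟨u, .refl u⟩) ?_
  rintro ⟨ι, s⟩ α ⟨_, s'⟩ t _ ⟨rfl, hstep⟩ - ih u hu ⟨v, hv, hend⟩
  dsimp only at hstep hv ih
  -- If the kernel run promised by `Represents` is empty, the state is in user mode or halted.
  -- Otherwise the actual step is the first step of that run.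
  rcases hv.cases_head with rfl | ⟨w, ⟨hk, hw⟩, hwv⟩
  · rcases hend with ⟨κ, hκ, rfl⟩ | hh
    · obtain ⟨c, i, hc, ⟨trpc, tr, u', hhit, he, rfl⟩ | ⟨rfl, rfl, α', u', he⟩⟩ :=
        hstep.user_cases
      · have hy : RuleYields CL i trpc tr := by
          obtain ⟨op, hop, -⟩ := he.ruleEncoded hu
          exact hκ i trpc tr hhit (hop ▸ op.code_ne_illegalOpcode)
        exact Machine.Produces.cons (M := userMachine CL TD _) ⟨c, i, trpc, tr, hc, hy, he⟩
          (ih (he.encoded hu hy.encodes.1 hy.encodes.2) ⟨_, .refl, .inl ⟨κ, hκ, rfl⟩⟩)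
      -- A miss leaves the user state where it is. The handler's run, ending with a valid cache or
      -- halted, witnesses `Represents` for the fault state.
      · obtain ⟨op, hop, hr⟩ := he.ruleEncoded hu
        refine ih hu ?_
        obtain ⟨v, hv, ⟨ha, rfl⟩ | hv'⟩ := faultHandler_correct hCL hop hr _
          (hasInput_setCache κ i) u.mem u.stack u.pc
        · exact ⟨_, hv, .inl ⟨_, cacheValid_of_hasInput (hasInput_setCache κ i) hop ha, rfl⟩⟩
        · exact ⟨_, hv, .inr hv'⟩
    · exact absurd hstep hh.not_step
  · obtain rfl := hstep.kernel_silent hk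
    obtain rfl := hstep.kernel_deterministic hk hw
    exact ih hu ⟨v, hwv, hend⟩

/-- The initial user state. -/
def initUState (i : CInput) : UState := ⟨initMem i.size i.tag, i.args.map .data, ⟨0, i.tag⟩⟩

theorem initUState_encoded (p : InstrMem) (args : List (Atom L)) (n : ℕ) (l : L) :
    (initUState ⟨p, args.map CL.encode, n, CL.Tag l⟩).Encoded CL := by
  refine ⟨fun q a hq => ?_, fun x hx => ?_, CL.encodes_tag l⟩
  · simp only [initUState, initMem] at hq
    split at hq
    · cases hq
      exact CL.encodes_tag l
    · cases hq
  · simp only [initUState, List.mem_map] at hx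
    obtain ⟨_, ⟨a, -, rfl⟩, rfl⟩ := hx
    exact CL.encodes_tag _

theorem initUState_indist {o : L} {i₁ i₂ : CInput} (h : InputIndist CL o i₁ i₂) :
    (initUState i₁).Indist CL o (initUState i₂) := by
  obtain ⟨p, args₁, args₂, n, l, h⟩ := h
  refine .of_stack (fun q => ?_) ?_ (.inl rfl)
  · dsimp only
    cases initMem n (CL.Tag l) q with
    | none => exact .none
    | some a => exact .some (.inl rfl)
  · simp only [List.map_map, List.forall₂_map_left_iff, List.forall₂_map_right_iff]
    refine h.imp fun a b hab => .data ?_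
    rcases hab with rfl | ⟨h₁, h₂⟩
    · exact .inl rfl
    · exact .inr ⟨by simpa [ConcreteLattice.encode, CL.lab_tag] using h₁,
        by simpa [ConcreteLattice.encode, CL.lab_tag] using h₂⟩

end Simulation

end IFC

theorem mainTheorem1 {L : Type*} [SemilatticeSup L] [OrderBot L] (TD : ℤ)
    (CL : IFC.ConcreteLattice L) (hCL : CL.Correct TD) :
    (IFC.concreteMachine TD (IFC.loadCode (IFC.genFaultHandler CL IFC.rulesAbs))).TINI
      (IFC.concreteObservation CL) := by
  intro o i₁ i₂ t₁ t₂ hi h₁ h₂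
  have hindist := IFC.initUState_indist hi
  obtain ⟨p, args₁, args₂, n, l, h⟩ := hi
  have produces {args : List (IFC.Atom L)} {t : List IFC.CAtom}
      (h : (IFC.concreteMachine TD (IFC.loadCode (IFC.genFaultHandler CL IFC.rulesAbs))).Produces
        (p, IFC.initCState TD ⟨p, args.map CL.encode, n, CL.Tag l⟩) t) :
      (IFC.userMachine CL TD p).Produces
        (IFC.initUState ⟨p, args.map CL.encode, n, CL.Tag l⟩) t :=
    IFC.produces_userMachine hCL h (IFC.initUState_encoded p args n l)
      -- The machine starts in user mode, so the kernel run is empty.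
      ⟨_, .refl, .inl ⟨_, IFC.cacheValid_initKMem, rfl⟩⟩
  exact IFC.userMachine_traceIndist hindist (produces h₁) (produces h₂)
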